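/- All $C^*$-algebras are arbitrary (not necessarily unital); modules are right Hilbert $C^*$-modules, and $\mathrm{End}_B(X)$ is the $C^*$-algebra of adjointable operators on $X_B$. An $A$--$B$-correspondence $(\phi,{}_AX_B)$ is a $*$-homomorphism $\phi\colon A\to\mathrm{End}_B(X)$ (degenerate ones are allowed). A positive $A$--$B$-correspondence $(\rho,{}_AX_B)$ is a completely positive map $\rho\colon A\to \mathrm{End}_B(X)$; it is strict if, for some approximate unit $(a_i)$ of $A$ consisting of positive contractions, $(\rho(a_i)x)_i$ and $(\rho(a_i)^*x)_i$ are Cauchy for every $x\in X$. Two (positive) $A$--$B$-correspondences $(\rho,X)$, $(\sigma,Y)$ are isomorphic if there is an adjointable unitary $U\colon X\to Y$ with $U\rho(a)U^*=\sigma(a)$ for all $a\in A$. For a completely positive $\rho\colon A\to\mathrm{End}_B(X)$, the KSGNS space $A\otimes_\rho X$ is the completion of $A\otimes_{\mathbb C}X$ modulo null vectors for $\langle a\otimes x\mid a'\otimes x'\rangle=\langle x\mid\rho(a^*a')x'\rangle_B$, with left action $\pi_\rho(a')(a\otimes x)=a'a\otimes x$. For a $B$--$C$-correspondence $(\phi,{}_BY_C)$,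 $X\otimes_BY$ is the interior tensor product, the completion of $X\otimes_{\mathbb C}Y$ modulo null vectors for $\langle x\otimes y\mid x'\otimes y'\rangle=\langle y\mid\phi(\langle x\mid x'\rangle_B)y'\rangle_C$. For positive correspondences $(\rho,{}_AX_B)$ and $(\sigma,{}_BY_C)$ put $$(\rho,{}_AX_B)\otimes(\sigma,{}_BY_C):=\bigl(\rho\otimes\mathrm{Id},\ X\otimes_B(B\otimes_\sigma Y)\bigr),$$ where $B$ acts on $B\otimes_\sigma Y$ by $\pi_\sigma$. Then the following hold. 1. Let $(\rho,{}_AX_B)$ be a strict positive correspondence and $(\phi,{}_BY_C)$ a $C^*$-correspondence. There is a strict completely positive map $\rho\otimes\mathrm{Id}\colon A\to\mathrm{End}_C(X\otimes_BY)$ with $(\rho\otimes\mathrm{Id})(a)(x\otimes y)=\rho(a)x\otimes y$ for all $a\in A$, $x\in X$, $y\in Y$, and there is an isomorphism of $A$--$C$-correspondences $$(\pi_\rho\otimes\mathrm{Id}_Y,\ (A\otimes_\rho X)\otimes_BY)\ \cong\ (\pi_{\rho\otimes\mathrm{Id}},\ A\otimes_{\rho\otimes\mathrm{Id}}(X\otimes_BY)).$$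 2. For strict positive correspondences $(\rho,{}_AX_B)$, $(\sigma,{}_BY_C)$, $(\tau,{}_CZ_D)$, $$\bigl((\rho,X)\otimes(\sigma,Y)\bigr)\otimes(\tau,Z)\ \cong\ (\rho,X)\otimes\bigl((\sigma,Y)\otimes(\tau,Z)\bigr).$$ 3. Consequently $\otimes$ sends strict positive correspondences to strict positive correspondences and induces a well-defined, associative composition of isomorphism classes of strict positive correspondences. -/

import Mathlib

set_option linter.unusedSectionVars false

open scoped TensorProduct CStarAlgebra

universe u v

noncomputable section

namespace CStarCorr

/-! ### Right Hilbert C*-modules -/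

/-- A complex vector space `V` with a right action of a C*-algebra `B` (written as an action of
`Bᵐᵒᵖ`) and a `B`-valued semi-inner product, linear in the second variable. -/
class PreHilbertModule (B V : Type*) [NonUnitalCStarAlgebra B] [PartialOrder B]
    [AddCommGroup V] [Module ℂ V] [SMul Bᵐᵒᵖ V] extends Inner B V where
  cinner_add_right (x y z : V) : inner x (y + z) = inner x y + inner x z
  cinner_smul_right (c : ℂ) (x y : V) : inner x (c • y) = c • inner x y
  cinner_op_smul_right (b : B) (x y : V) : inner x (MulOpposite.op b • y) = inner x y * b
  star_cinner (x y : V) : star (inner x y) = inner y x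
  cinner_self_nonneg (x : V) : 0 ≤ inner x x

/-- A seminormed space whose seminorm is the one of a `B`-valued semi-inner product. -/
class SemiHilbertModule (B V : Type*) [NonUnitalCStarAlgebra B] [PartialOrder B]
    [SeminormedAddCommGroup V] [NormedSpace ℂ V] [SMul Bᵐᵒᵖ V] extends PreHilbertModule B V where
  norm_sq_eq (x : V) : ‖x‖ ^ 2 = ‖inner x x‖

/-- A right Hilbert C*-module over `B`: complete, with `‖x‖² = ‖⟨x, x⟩‖`, where the norm is
definite. (All the laws of a right `B`-module follow from these axioms, because an element `x` is
determined by the values `⟨y, x⟩`.) -/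
class HilbertModule (B X : Type*) [NonUnitalCStarAlgebra B] [PartialOrder B]
    [NormedAddCommGroup X] [NormedSpace ℂ X] [SMul Bᵐᵒᵖ X] extends
    SemiHilbertModule B X where
  complete : CompleteSpace X

section PreHilbert

variable {B V : Type*} [NonUnitalCStarAlgebra B] [PartialOrder B]
  [AddCommGroup V] [Module ℂ V] [SMul Bᵐᵒᵖ V] [PreHilbertModule B V]

open PreHilbertModule

theorem cinner_add_left (x y z : V) : inner B (x + y) z = inner B x z + inner B y z := by
  rw [← star_cinner, cinner_add_right, star_add, star_cinner, star_cinner]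

theorem cinner_smul_left (c : ℂ) (x y : V) : inner B (c • x) y = star c • inner B x y := by
  rw [← star_cinner, cinner_smul_right, star_smul, star_cinner]

theorem cinner_op_smul_left (b : B) (x y : V) :
    inner B (MulOpposite.op b • x) y = star b * inner B x y := by
  rw [← star_cinner, cinner_op_smul_right, star_mul, star_cinner]

theorem cinner_zero_right (x : V) : inner B x (0 : V) = 0 := by
  simpa using cinner_smul_right (B := B) (0 : ℂ) x (0 : V)

theorem cinner_zero_left (x : V) : inner B (0 : V) x = 0 := by
  rw [← star_cinner, cinner_zero_right, star_zero]

theorem cinner_neg_right (x y : V) : inner B x (-y) = -inner B x y := by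
  simpa using cinner_smul_right (B := B) (-1 : ℂ) x y

theorem cinner_sub_right (x y z : V) : inner B x (y - z) = inner B x y - inner B x z := by
  rw [sub_eq_add_neg, cinner_add_right, cinner_neg_right, sub_eq_add_neg]

theorem cinner_sub_left (x y z : V) : inner B (x - y) z = inner B x z - inner B y z := by
  rw [← star_cinner, cinner_sub_right, star_sub, star_cinner, star_cinner]

theorem cinner_sum_right {ι : Type*} (s : Finset ι) (x : V) (f : ι → V) :
    inner B x (∑ i ∈ s, f i) = ∑ i ∈ s, inner B x (f i) := by
  classical
  induction s using Finset.induction_on with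
  | empty => simp [cinner_zero_right]
  | insert a s ha ih => rw [Finset.sum_insert ha, Finset.sum_insert ha, cinner_add_right, ih]

theorem cinner_sum_left {ι : Type*} (s : Finset ι) (f : ι → V) (x : V) :
    inner B (∑ i ∈ s, f i) x = ∑ i ∈ s, inner B (f i) x := by
  rw [← star_cinner, cinner_sum_right, star_sum]
  simp only [star_cinner]

variable [StarOrderedRing B]

theorem norm_cinner_sq_le (x y : V) :
    ‖inner B x y‖ ^ 2 ≤ ‖inner B x x‖ * ‖inner B y y‖ := by
  set p := inner B x x with hp
  set q := inner B y y with hq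
  set c := inner B x y with hc
  have key : ∀ t : ℝ, ‖p‖ < t → ‖c‖ ^ 2 ≤ t * ‖q‖ := by
    intro t ht
    have ht0 : 0 < t := (norm_nonneg _).trans_lt ht
    have h0 : 0 ≤ star c * p * c - t • (star c * c) - t • (star c * c) + t • t • q := by
      have h := cinner_self_nonneg (B := B) (MulOpposite.op c • x - (t : ℂ) • y)
      have hyx : inner B y x = star c := (star_cinner x y).symm
      simp only [cinner_sub_right, cinner_sub_left, cinner_op_smul_right, cinner_op_smul_left,
        cinner_smul_right, cinner_smul_left, hyx, ← hp, ← hq, ← hc, RCLike.star_def,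
        Complex.conj_ofReal] at h
      simp only [Complex.coe_smul, sub_mul, smul_sub, smul_mul_assoc] at h
      convert h using 1
      abel
    have h1 : star c * p * c ≤ t • (star c * c) :=
      (CStarAlgebra.star_left_conjugate_le_norm_smul
        (IsSelfAdjoint.of_nonneg (cinner_self_nonneg x))).trans
        (smul_le_smul_of_nonneg_right ht.le (star_mul_self_nonneg c))
    have h2 : t • (star c * c) ≤ t • t • q := by
      rw [← sub_nonneg]
      have := add_nonneg h0 (sub_nonneg.mpr h1)
      convert this using 1
      abel
    have h3 : star c * c ≤ t • q := (smul_le_smul_iff_of_pos_left ht0).mp h2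
    have h4 := CStarAlgebra.norm_le_norm_of_nonneg_of_le (star_mul_self_nonneg c) h3
    rw [CStarRing.norm_star_mul_self, norm_smul, Real.norm_of_nonneg ht0.le, ← sq] at h4
    exact h4
  refine le_of_forall_pos_le_add fun ε hε => ?_
  have hq0 := norm_nonneg q
  refine (key (‖p‖ + ε / (‖q‖ + 1)) (by simp; positivity)).trans ?_
  have : ε / (‖q‖ + 1) * ‖q‖ ≤ ε := by
    rw [div_mul_eq_mul_div, div_le_iff₀ (by positivity)]
    nlinarith
  nlinarith

variable (B V) in
/-- The seminorm `‖x‖ = ‖⟨x, x⟩‖^(1/2)` of a semi-inner product. -/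
abbrev PreHilbertModule.toNorm : Norm V where
  norm x := √‖inner B x x‖

variable (B V) in
theorem PreHilbertModule.core :
    @SeminormedSpace.Core ℂ V _ _ (PreHilbertModule.toNorm B V) _ := by
  let := PreHilbertModule.toNorm B V
  refine ⟨fun x => Real.sqrt_nonneg _, fun c x => ?_, fun x y => ?_⟩
  · change √‖inner B (c • x) (c • x)‖ = ‖c‖ * √‖inner B x x‖
    rw [cinner_smul_right, cinner_smul_left, norm_smul, norm_smul, norm_star, ← mul_assoc,
      Real.sqrt_mul (by positivity), Real.sqrt_mul_self (norm_nonneg c)]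
  · change √‖inner B (x + y) (x + y)‖ ≤ √‖inner B x x‖ + √‖inner B y y‖
    have hxy : ‖inner B x y‖ ≤ √‖inner B x x‖ * √‖inner B y y‖ := by
      rw [← Real.sqrt_mul (norm_nonneg _)]
      exact Real.le_sqrt_of_sq_le (norm_cinner_sq_le x y)
    have hyx : ‖inner B y x‖ ≤ √‖inner B x x‖ * √‖inner B y y‖ := by
      rw [← star_cinner, norm_star]; exact hxy
    rw [Real.sqrt_le_left (by positivity)]
    have hx := Real.sq_sqrt (norm_nonneg (inner B x x))
    have hy := Real.sq_sqrt (norm_nonneg (inner B y y))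
    rw [cinner_add_right, cinner_add_left, cinner_add_left]
    have h := norm_add_le (inner B x x + inner B y x) (inner B x y + inner B y y)
    have h1 := norm_add_le (inner B x x) (inner B y x)
    have h2 := norm_add_le (inner B x y) (inner B y y)
    nlinarith

variable (B V) in
/-- The seminormed group of a semi-inner product. -/
abbrev PreHilbertModule.toSeminormed : SeminormedAddCommGroup V :=
  letI := PreHilbertModule.toNorm B V
  SeminormedAddCommGroup.ofCore (PreHilbertModule.core B V)

end PreHilbert

/-! ### Completion -/

section Completion

variable {B V : Type*} [NonUnitalCStarAlgebra B] [PartialOrder B] [StarOrderedRing B]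
  [SeminormedAddCommGroup V] [NormedSpace ℂ V] [SMul Bᵐᵒᵖ V] [SemiHilbertModule B V]

open PreHilbertModule SemiHilbertModule

theorem norm_cinner_le (x y : V) : ‖inner B x y‖ ≤ ‖x‖ * ‖y‖ := by
  refine abs_le_of_sq_le_sq' ?_ (by positivity) |>.2
  rw [mul_pow, norm_sq_eq (B := B) x, norm_sq_eq (B := B) y]
  exact norm_cinner_sq_le x y

theorem continuous_cinner : Continuous fun p : V × V => inner B p.1 p.2 := by
  let f : V →ₗ⋆[ℂ] V →ₗ[ℂ] B := LinearMap.mk₂'ₛₗ (starRingEnd ℂ) (RingHom.id ℂ)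
    (fun x y => inner B x y) cinner_add_left (fun c x y => cinner_smul_left c x y)
    cinner_add_right (fun c x y => cinner_smul_right c x y)
  let g : V →L⋆[ℂ] V →L[ℂ] B := f.mkContinuous₂ 1
    (fun x y => by rw [one_mul]; exact norm_cinner_le x y)
  have hg : Continuous fun p : V × V => g p.1 p.2 := by fun_prop
  exact hg

variable (B) in
theorem norm_op_smul_le (b : B) (x : V) : ‖MulOpposite.op b • x‖ ≤ ‖b‖ * ‖x‖ := by
  refine abs_le_of_sq_le_sq' ?_ (by positivity) |>.2
  rw [norm_sq_eq (B := B), cinner_op_smul_right, cinner_op_smul_left, mul_pow,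
    norm_sq_eq (B := B) x]
  calc _ ≤ ‖star b‖ * ‖inner B x x‖ * ‖b‖ :=
        (norm_mul_le _ _).trans (by gcongr; exact norm_mul_le _ _)
    _ = _ := by rw [norm_star]; ring

theorem norm_eq_zero_of_inner_eq_zero (x : V) (h : ∀ y, inner B y x = 0) : ‖x‖ = 0 := by
  have := norm_sq_eq (B := B) x
  rw [h x, norm_zero] at this
  exact pow_eq_zero_iff (two_ne_zero) |>.mp this

theorem norm_sub_eq_zero_of_inner (x y : V) (h : ∀ z, inner B z x = inner B z y) :
    ‖x - y‖ = 0 :=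
  norm_eq_zero_of_inner_eq_zero (B := B) _ fun z => by rw [cinner_sub_right, h, sub_self]

variable (B V) in
theorem uniformContinuousConstSMul_op : UniformContinuousConstSMul Bᵐᵒᵖ V where
  uniformContinuous_const_smul b := by
    refine (LipschitzWith.of_dist_le_mul (K := ‖b.unop‖₊) fun x y => ?_).uniformContinuous
    rw [dist_eq_norm, dist_eq_norm]
    have h : ‖(b • x - b • y) - b • (x - y)‖ = 0 := by
      refine norm_sub_eq_zero_of_inner (B := B) _ _ fun z => ?_
      obtain ⟨b, rfl⟩ := MulOpposite.op_surjective b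
      rw [cinner_sub_right, cinner_op_smul_right, cinner_op_smul_right, cinner_op_smul_right,
        cinner_sub_right, sub_mul]
    have h' : ‖b • x - b • y‖ ≤ ‖b • (x - y)‖ := by
      calc _ = ‖((b • x - b • y) - b • (x - y)) + b • (x - y)‖ := by rw [sub_add_cancel]
        _ ≤ _ := norm_add_le _ _
        _ = _ := by rw [h, zero_add]
    exact h'.trans (norm_op_smul_le B b.unop _)

open UniformSpace

theorem completion_inner_coe (x y : V) :
    inner B (x : Completion V) (y : Completion V) = inner B x y :=
  (Completion.isDenseInducing_coe.prodMap Completion.isDenseInducing_coe).extend_eq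
    (continuous_cinner (B := B) (V := V)) (x, y)

theorem completion_continuous_cinner :
    Continuous fun p : Completion V × Completion V => inner B p.1 p.2 := by
  let f : V →+ V →+ B :=
    { toFun := fun x => AddMonoidHom.mk' (fun y => inner B x y) (cinner_add_right x)
      map_zero' := by ext y; exact cinner_zero_left y
      map_add' := fun x y => by ext z; exact cinner_add_left x y z }
  have hf : Continuous fun p : V × V => f p.1 p.2 := continuous_cinner
  exact (Completion.isDenseInducing_toCompl V).extend_Z_bilin
    (Completion.isDenseInducing_toCompl V) hf

theorem Continuous.cinner {α : Type*} [TopologicalSpace α] {f g : α → Completion V}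
    (hf : Continuous f) (hg : Continuous g) : Continuous fun a => inner B (f a) (g a) :=
  completion_continuous_cinner.comp (hf.prodMk hg)

theorem completion_inner_add_right (x y z : Completion V) :
    inner B x (y + z) = inner B x y + inner B x z := by
  refine Completion.induction_on₃ x y z (isClosed_eq ?_ ?_) fun x y z => ?_
  · exact Continuous.cinner continuous_fst
      ((continuous_fst.comp continuous_snd).add (continuous_snd.comp continuous_snd))
  · exact (Continuous.cinner continuous_fst (continuous_fst.comp continuous_snd)).add
      (Continuous.cinner continuous_fst (continuous_snd.comp continuous_snd))
  · rw [← Completion.coe_add, completion_inner_coe, completion_inner_coe, completion_inner_coe,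
      cinner_add_right]

theorem completion_inner_smul_right (c : ℂ) (x y : Completion V) :
    inner B x (c • y) = c • inner B x y := by
  refine Completion.induction_on₂ x y (isClosed_eq ?_ ?_) fun x y => ?_
  · exact Continuous.cinner continuous_fst (continuous_snd.const_smul c)
  · exact (Continuous.cinner continuous_fst continuous_snd).const_smul c
  · rw [← Completion.coe_smul, completion_inner_coe, completion_inner_coe, cinner_smul_right]

theorem completion_inner_op_smul_right (b : B) (x y : Completion V) :
    inner B x (MulOpposite.op b • y) = inner B x y * b := by
  have := uniformContinuousConstSMul_op B V
  refine Completion.induction_on₂ x y (isClosed_eq ?_ ?_) fun x y => ?_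
  · exact Continuous.cinner continuous_fst (Completion.continuous_map.comp continuous_snd)
  · exact (Continuous.cinner continuous_fst continuous_snd).mul continuous_const
  · rw [← Completion.coe_smul, completion_inner_coe, completion_inner_coe, cinner_op_smul_right]

theorem completion_star_inner (x y : Completion V) : star (inner B x y) = inner B y x := by
  refine Completion.induction_on₂ x y (isClosed_eq ?_ ?_) fun x y => ?_
  · exact (Continuous.cinner continuous_fst continuous_snd).star
  · exact Continuous.cinner continuous_snd continuous_fst
  · rw [completion_inner_coe, completion_inner_coe, star_cinner]

theorem completion_inner_self_nonneg (x : Completion V) : 0 ≤ inner B x x := by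
  refine Completion.induction_on x ?_ fun x => ?_
  · exact CStarAlgebra.isClosed_nonneg.preimage (Continuous.cinner continuous_id continuous_id)
  · rw [completion_inner_coe]; exact cinner_self_nonneg x

theorem completion_norm_sq_eq (x : Completion V) : ‖x‖ ^ 2 = ‖inner B x x‖ := by
  refine Completion.induction_on x (isClosed_eq ?_ ?_) fun x => ?_
  · exact continuous_norm.pow 2
  · exact (Continuous.cinner continuous_id continuous_id).norm
  · rw [completion_inner_coe, Completion.norm_coe, norm_sq_eq (B := B)]

/-- The (separated) completion of a semi-inner product module is a Hilbert module; the inner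
product and the right action are the continuous extensions. -/
instance instHilbertModuleCompletion : HilbertModule B (Completion V) where
  cinner_add_right := completion_inner_add_right
  cinner_smul_right := completion_inner_smul_right
  cinner_op_smul_right := completion_inner_op_smul_right
  star_cinner := completion_star_inner
  cinner_self_nonneg := completion_inner_self_nonneg
  norm_sq_eq := completion_norm_sq_eq
  complete := inferInstance

end Completion

/-! ### Adjointable operators -/

section Adjointable

variable {B X : Type*} [NonUnitalCStarAlgebra B] [PartialOrder B] [StarOrderedRing B]
  [NormedAddCommGroup X] [NormedSpace ℂ X] [SMul Bᵐᵒᵖ X] [HilbertModule B X]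

open PreHilbertModule SemiHilbertModule

variable (B) in
theorem ext_cinner {x y : X} (h : ∀ z, inner B z x = inner B z y) : x = y := by
  rw [← sub_eq_zero, ← norm_eq_zero]
  exact norm_sub_eq_zero_of_inner x y h

variable (B) in
theorem ext_cinner_right {x y : X} (h : ∀ z, inner B x z = inner B y z) : x = y :=
  ext_cinner B fun z => by rw [← star_cinner, h, star_cinner]

variable (B X) in
/-- The bounded operators `T` on `X` that have an adjoint: `⟨T x, y⟩ = ⟨x, S y⟩`. -/
def adjointable : Subalgebra ℂ (X →L[ℂ] X) where
  carrier := {T | ∃ S : X →L[ℂ] X, ∀ x y, inner B (T x) y = inner B x (S y)}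
  mul_mem' := by
    rintro T T' ⟨S, hS⟩ ⟨S', hS'⟩
    exact ⟨S' * S, fun x y => by
      rw [mul_apply_eq_comp, hS, hS', mul_apply_eq_comp]⟩
  add_mem' := by
    rintro T T' ⟨S, hS⟩ ⟨S', hS'⟩
    exact ⟨S + S', fun x y => by
      rw [_root_.add_apply, cinner_add_left, hS, hS', _root_.add_apply,
        cinner_add_right]⟩
  algebraMap_mem' := fun c => ⟨algebraMap ℂ (X →L[ℂ] X) (star c), fun x y => by
    simp only [Algebra.algebraMap_eq_smul_one, _root_.smul_apply,
      one_apply_eq_self, cinner_smul_left, cinner_smul_right]⟩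

variable (B X) in
/-- `End_B(X)`: the algebra of adjointable operators on the Hilbert module `X`. -/
def Adj : Type _ := adjointable B X

namespace Adj

instance : NormedRing (Adj B X) := inferInstanceAs (NormedRing (adjointable B X))

instance : NormedAlgebra ℂ (Adj B X) := inferInstanceAs (NormedAlgebra ℂ (adjointable B X))

/-- The underlying bounded operator. -/
def toCLM (T : Adj B X) : X →L[ℂ] X := T.1

instance : CoeFun (Adj B X) (fun _ => X → X) := ⟨fun T => T.toCLM⟩

theorem ext {T S : Adj B X} (h : ∀ x, T x = S x) : T = S :=
  Subtype.ext (ContinuousLinearMap.ext h)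

theorem add_apply (S T : Adj B X) (x : X) : (S + T) x = S x + T x := rfl

theorem sub_apply (S T : Adj B X) (x : X) : (S - T) x = S x - T x := rfl

theorem mul_apply (S T : Adj B X) (x : X) : (S * T) x = S (T x) := rfl

theorem smul_apply (c : ℂ) (T : Adj B X) (x : X) : (c • T) x = c • T x := rfl

theorem zero_apply (x : X) : (0 : Adj B X) x = 0 := rfl

theorem one_apply (x : X) : (1 : Adj B X) x = x := rfl

theorem norm_def (T : Adj B X) : ‖T‖ = ‖T.toCLM‖ := rfl

theorem le_opNorm (T : Adj B X) (x : X) : ‖T x‖ ≤ ‖T‖ * ‖x‖ := T.toCLM.le_opNorm x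

/-- Build an adjointable operator from an adjoint pair. -/
def mk (T S : X →L[ℂ] X) (h : ∀ x y, inner B (T x) y = inner B x (S y)) : Adj B X := ⟨T, S, h⟩

theorem mk_apply (T S : X →L[ℂ] X) (h : ∀ x y, inner B (T x) y = inner B x (S y)) (x : X) :
    mk T S h x = T x := rfl

/-- The adjoint operator. -/
instance : Star (Adj B X) where
  star T := mk T.2.choose T.1 fun x y => by
    rw [← star_cinner, ← T.2.choose_spec, star_cinner]

theorem inner_star_right (T : Adj B X) (x y : X) :
    inner B x (star T y) = inner B (T x) y := (T.2.choose_spec x y).symm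

theorem inner_star_left (T : Adj B X) (x y : X) :
    inner B (star T x) y = inner B x (T y) := by
  rw [← star_cinner, inner_star_right, star_cinner]

theorem star_eq_of (T S : Adj B X) (h : ∀ x y, inner B (T x) y = inner B x (S y)) :
    star T = S :=
  ext fun y => ext_cinner B fun x => by rw [inner_star_right, h]

theorem map_op_smul (T : Adj B X) (b : B) (x : X) :
    T (MulOpposite.op b • x) = MulOpposite.op b • T x :=
  ext_cinner B fun z => by
    rw [← inner_star_left, cinner_op_smul_right, cinner_op_smul_right, inner_star_left]

instance : StarRing (Adj B X) where
  star_involutive T := star_eq_of _ _ fun x y => inner_star_left T x y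
  star_mul S T := star_eq_of _ _ fun x y => by
    rw [mul_apply, mul_apply, inner_star_right, inner_star_right]
  star_add S T := star_eq_of _ _ fun x y => by
    rw [add_apply, add_apply, cinner_add_left, cinner_add_right, inner_star_right,
      inner_star_right]

instance : StarModule ℂ (Adj B X) where
  star_smul c T := star_eq_of _ _ fun x y => by
    rw [smul_apply, smul_apply, cinner_smul_left, cinner_smul_right, inner_star_right]

theorem sq_norm_le (T : Adj B X) : ‖T‖ ≤ √‖star T * T‖ := by
  refine T.toCLM.opNorm_le_bound (Real.sqrt_nonneg _) fun x => ?_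
  refine abs_le_of_sq_le_sq' ?_ (by positivity) |>.2
  rw [mul_pow, Real.sq_sqrt (norm_nonneg _)]
  calc ‖T x‖ ^ 2 = ‖inner B x ((star T * T) x)‖ := by
        rw [norm_sq_eq (B := B), mul_apply, inner_star_right]
    _ ≤ ‖x‖ * ‖(star T * T) x‖ := norm_cinner_le _ _
    _ ≤ ‖x‖ * (‖star T * T‖ * ‖x‖) := by gcongr; exact le_opNorm _ _
    _ = _ := by ring

instance : CStarRing (Adj B X) where
  norm_mul_self_le T := by
    have h := sq_norm_le T
    calc ‖T‖ * ‖T‖ ≤ √‖star T * T‖ * √‖star T * T‖ := by gcongr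
      _ = _ := Real.mul_self_sqrt (norm_nonneg _)

theorem isClosed_adjointable : IsClosed (adjointable B X : Set (X →L[ℂ] X)) := by
  refine isClosed_of_closure_subset fun T hT => ?_
  obtain ⟨u, hu, hlim⟩ := mem_closure_iff_seq_limit.mp hT
  let U : ℕ → Adj B X := fun n => ⟨u n, hu n⟩
  have hc : CauchySeq fun n => (star (U n)).toCLM := by
    have h1 := hlim.cauchySeq
    rw [Metric.cauchySeq_iff] at h1 ⊢
    intro ε hε
    obtain ⟨N, hN⟩ := h1 ε hε
    refine ⟨N, fun m hm n hn => ?_⟩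
    have h2 : dist (star (U m)).toCLM (star (U n)).toCLM = dist (u m) (u n) := by
      rw [dist_eq_norm, dist_eq_norm]
      calc _ = ‖star (U m) - star (U n)‖ := rfl
        _ = ‖U m - U n‖ := by rw [← star_sub, norm_star]
        _ = _ := rfl
    rw [h2]
    exact hN m hm n hn
  have hcs : CompleteSpace X := HilbertModule.complete B
  obtain ⟨S, hS⟩ := cauchySeq_tendsto_of_complete hc
  refine ⟨S, fun x y => ?_⟩
  have hl : Filter.Tendsto (fun n => inner B (u n x) y) Filter.atTop (nhds (inner B (T x) y)) := by
    have h3 : Filter.Tendsto (fun n => u n x) Filter.atTop (nhds (T x)) :=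
      ((ContinuousLinearMap.apply ℂ X x).continuous.tendsto T).comp hlim
    exact (continuous_cinner (B := B) (V := X)).tendsto (T x, y) |>.comp
      (h3.prodMk_nhds tendsto_const_nhds)
  have hr : Filter.Tendsto (fun n => inner B x ((star (U n)) y)) Filter.atTop
      (nhds (inner B x (S y))) := by
    have h3 : Filter.Tendsto (fun n => (star (U n)) y) Filter.atTop (nhds (S y)) :=
      ((ContinuousLinearMap.apply ℂ X y).continuous.tendsto S).comp hS
    exact (continuous_cinner (B := B) (V := X)).tendsto (x, S y) |>.comp
      (tendsto_const_nhds.prodMk_nhds h3)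
  refine tendsto_nhds_unique hl (hr.congr fun n => ?_)
  exact inner_star_right (U n) x y

instance : CompleteSpace (Adj B X) :=
  have : CompleteSpace X := HilbertModule.complete B
  isClosed_adjointable.completeSpace_coe

instance : CStarAlgebra (Adj B X) where

instance : PartialOrder (Adj B X) := CStarAlgebra.spectralOrder (Adj B X)

instance : StarOrderedRing (Adj B X) := CStarAlgebra.spectralOrderedRing (Adj B X)

end Adj

end Adjointable

/-! ### The Hilbert module of a positive definite kernel

Both the KSGNS space `A ⊗_ρ X` and the interior tensor product `X ⊗_B Y` are completions of an
algebraic tensor product `S ⊗_ℂ Y` (with `S = A`, respectively `S = X`) for a semi-inner product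
`⟨s ⊗ y, s' ⊗ y'⟩ = ⟨y, K(s, s') y'⟩`, where `K(a, a') = ρ(a* a')`, respectively
`K(x, x') = φ(⟨x, x'⟩)`. -/

/-- A sesquilinear positive definite kernel on a complex vector space `S` with values in the
adjointable operators on the Hilbert `C`-module `Y`. -/
structure PosKernel (C S Y : Type*) [NonUnitalCStarAlgebra C] [PartialOrder C]
    [StarOrderedRing C] [AddCommGroup S] [Module ℂ S] [NormedAddCommGroup Y] [NormedSpace ℂ Y]
    [SMul Cᵐᵒᵖ Y] [HilbertModule C Y] where
  toFun : S →ₗ⋆[ℂ] S →ₗ[ℂ] Adj C Y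
  star_apply (s t : S) : star (toFun s t) = toFun t s
  pos (n : ℕ) (s : Fin n → S) (y : Fin n → Y) :
    0 ≤ ∑ i, ∑ j, inner C (y i) (toFun (s i) (s j) (y j))

section Kernel

variable {C S Y : Type*} [NonUnitalCStarAlgebra C] [PartialOrder C]
    [StarOrderedRing C] [AddCommGroup S] [Module ℂ S] [NormedAddCommGroup Y] [NormedSpace ℂ Y]
    [SMul Cᵐᵒᵖ Y] [HilbertModule C Y]

open PreHilbertModule SemiHilbertModule

/-- The right action of `c` on a Hilbert module as a linear map. -/
def rightMul (c : C) : Y →ₗ[ℂ] Y where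
  toFun y := MulOpposite.op c • y
  map_add' x y := ext_cinner C fun z => by
    simp only [cinner_op_smul_right, cinner_add_right, add_mul]
  map_smul' r x := ext_cinner C fun z => by
    simp only [cinner_op_smul_right, cinner_smul_right, RingHom.id_apply, smul_mul_assoc]

namespace PosKernel

/-- The algebraic tensor product `S ⊗_ℂ Y`, carrying the semi-inner product of the kernel `K`. -/
def Pre (_K : PosKernel C S Y) : Type _ := S ⊗[ℂ] Y

variable (K : PosKernel C S Y)

instance : AddCommGroup K.Pre := inferInstanceAs (AddCommGroup (S ⊗[ℂ] Y))

instance : Module ℂ K.Pre := inferInstanceAs (Module ℂ (S ⊗[ℂ] Y))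

/-- The elementary tensor `s ⊗ y`. -/
def tmul (s : S) (y : Y) : K.Pre := s ⊗ₜ[ℂ] y

/-- The right action `(s ⊗ y) c = s ⊗ y c`. -/
instance : SMul Cᵐᵒᵖ K.Pre :=
  ⟨fun c v => (LinearMap.lTensor S (rightMul c.unop) : S ⊗[ℂ] Y →ₗ[ℂ] S ⊗[ℂ] Y) v⟩

theorem op_smul_tmul (c : C) (s : S) (y : Y) :
    MulOpposite.op c • K.tmul s y = K.tmul s (MulOpposite.op c • y) := rfl

theorem op_smul_add (c : C) (u v : K.Pre) :
    MulOpposite.op c • (u + v) = MulOpposite.op c • u + MulOpposite.op c • v :=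
  (LinearMap.lTensor S (rightMul (Y := Y) c)).map_add u v

theorem op_smul_zero (c : C) : MulOpposite.op c • (0 : K.Pre) = 0 :=
  (LinearMap.lTensor S (rightMul (Y := Y) c)).map_zero

@[elab_as_elim]
theorem induction {p : K.Pre → Prop} (zero : p 0) (tmul : ∀ s y, p (K.tmul s y))
    (add : ∀ u v, p u → p v → p (u + v)) (v : K.Pre) : p v :=
  TensorProduct.induction_on (motive := p) v zero tmul add

/-- The map `s' ⊗ y' ↦ ⟨y, K(s, s') y'⟩`. -/
def formRight (s : S) (y : Y) : S ⊗[ℂ] Y →ₗ[ℂ] C :=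
  TensorProduct.lift (LinearMap.mk₂ ℂ (fun s' y' => inner C y (K.toFun s s' y'))
    (fun a b z => by rw [map_add, Adj.add_apply, cinner_add_right])
    (fun c a z => by rw [map_smul, Adj.smul_apply, cinner_smul_right])
    (fun a z w => by rw [map_add, cinner_add_right])
    (fun c a z => by rw [map_smul, cinner_smul_right]))

/-- The sesquilinear form `⟨s ⊗ y, s' ⊗ y'⟩ = ⟨y, K(s, s') y'⟩`. -/
def form : S ⊗[ℂ] Y →ₗ⋆[ℂ] S ⊗[ℂ] Y →ₗ[ℂ] C :=
  TensorProduct.lift (LinearMap.mk₂'ₛₗ (starRingEnd ℂ) (starRingEnd ℂ) K.formRight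
    (fun a b z => by
      refine TensorProduct.ext' fun s y => ?_
      simp only [formRight, TensorProduct.lift.tmul, LinearMap.mk₂_apply, LinearMap.add_apply,
        map_add, Adj.add_apply, cinner_add_right])
    (fun c a z => by
      refine TensorProduct.ext' fun s y => ?_
      simp only [formRight, TensorProduct.lift.tmul, LinearMap.mk₂_apply, LinearMap.smul_apply,
        LinearMap.map_smulₛₗ, Adj.smul_apply, cinner_smul_right])
    (fun a z w => by
      refine TensorProduct.ext' fun s y => ?_
      simp only [formRight, TensorProduct.lift.tmul, LinearMap.mk₂_apply, LinearMap.add_apply,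
        cinner_add_left])
    (fun c a z => by
      refine TensorProduct.ext' fun s y => ?_
      simp only [formRight, TensorProduct.lift.tmul, LinearMap.mk₂_apply, LinearMap.smul_apply,
        cinner_smul_left, starRingEnd_apply]))

instance : Inner C K.Pre := ⟨fun u v => K.form u v⟩

theorem inner_def (u v : K.Pre) : inner C u v = K.form u v := rfl

theorem inner_tmul (s s' : S) (y y' : Y) :
    inner C (K.tmul s y) (K.tmul s' y') = inner C y (K.toFun s s' y') := rfl

theorem pre_inner_add_right (u v w : K.Pre) :
    inner C u (v + w) = inner C u v + inner C u w := (K.form u).map_add v w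

theorem pre_inner_add_left (u v w : K.Pre) :
    inner C (u + v) w = inner C u w + inner C v w := K.form.map_add₂ u v w

theorem pre_inner_zero_right (u : K.Pre) : inner C u (0 : K.Pre) = 0 := (K.form u).map_zero

theorem pre_inner_zero_left (u : K.Pre) : inner C (0 : K.Pre) u = 0 := K.form.map_zero₂ u

theorem pre_star_inner (u v : K.Pre) : star (inner C u v) = inner C v u := by
  induction u using K.induction with
  | zero => rw [pre_inner_zero_left, pre_inner_zero_right, star_zero]
  | add u u' h h' => rw [pre_inner_add_left, pre_inner_add_right, star_add, h, h']
  | tmul s y =>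
    induction v using K.induction with
    | zero => rw [pre_inner_zero_left, pre_inner_zero_right, star_zero]
    | add u u' h h' => rw [pre_inner_add_left, pre_inner_add_right, star_add, h, h']
    | tmul s' y' =>
      rw [inner_tmul, inner_tmul, star_cinner, ← K.star_apply s' s, Adj.inner_star_left]

theorem pre_inner_op_smul_right (c : C) (u v : K.Pre) :
    inner C u (MulOpposite.op c • v) = inner C u v * c := by
  induction v using K.induction with
  | zero => rw [op_smul_zero, pre_inner_zero_right, zero_mul]
  | add v v' h h' => rw [op_smul_add, pre_inner_add_right, pre_inner_add_right, h, h', add_mul]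
  | tmul s' y' =>
    induction u using K.induction with
    | zero => rw [pre_inner_zero_left, pre_inner_zero_left, zero_mul]
    | add u u' h h' => rw [pre_inner_add_left, pre_inner_add_left, h, h', add_mul]
    | tmul s y =>
      rw [op_smul_tmul, inner_tmul, inner_tmul, Adj.map_op_smul, cinner_op_smul_right]

theorem pre_inner_self_nonneg (u : K.Pre) : 0 ≤ inner C u u := by
  obtain ⟨n, s, y, rfl⟩ := TensorProduct.exists_sum_tmul_eq (R := ℂ) (M := S) (N := Y) u
  have h := K.pos n s y
  have h2 : inner C (show K.Pre from ∑ j, s j ⊗ₜ[ℂ] y j) (show K.Pre from ∑ j, s j ⊗ₜ[ℂ] y j) =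
      ∑ i, ∑ j, inner C (y i) (K.toFun (s i) (s j) (y j)) := by
    change K.form (∑ j, s j ⊗ₜ[ℂ] y j) (∑ j, s j ⊗ₜ[ℂ] y j) = _
    rw [LinearMap.map_sum₂]
    refine Finset.sum_congr rfl fun i _ => ?_
    rw [map_sum]
    rfl
  exact h.trans_eq h2.symm

instance : PreHilbertModule C K.Pre where
  cinner_add_right := K.pre_inner_add_right
  cinner_smul_right c u v := (K.form u).map_smul c v
  cinner_op_smul_right := K.pre_inner_op_smul_right
  star_cinner := K.pre_star_inner
  cinner_self_nonneg := K.pre_inner_self_nonneg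

instance : SeminormedAddCommGroup K.Pre := PreHilbertModule.toSeminormed C K.Pre

instance : NormedSpace ℂ K.Pre where
  norm_smul_le c x := ((PreHilbertModule.core C K.Pre).norm_smul c x).le

instance : SemiHilbertModule C K.Pre where
  norm_sq_eq x := Real.sq_sqrt (norm_nonneg (inner C x x))

/-- The completion of (the separated quotient of) `S ⊗_ℂ Y` for the semi-inner product
`⟨s ⊗ y, s' ⊗ y'⟩ = ⟨y, K(s, s') y'⟩`. -/
def Space : Type _ := UniformSpace.Completion K.Pre

instance : NormedAddCommGroup K.Space :=
  inferInstanceAs (NormedAddCommGroup (UniformSpace.Completion K.Pre))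

instance : NormedSpace ℂ K.Space :=
  inferInstanceAs (NormedSpace ℂ (UniformSpace.Completion K.Pre))

instance : SMul Cᵐᵒᵖ K.Space :=
  inferInstanceAs (SMul Cᵐᵒᵖ (UniformSpace.Completion K.Pre))

instance : HilbertModule C K.Space :=
  inferInstanceAs (HilbertModule C (UniformSpace.Completion K.Pre))

/-- The class of the elementary tensor `s ⊗ y` in the completion. -/
def elem (s : S) (y : Y) : K.Space := (K.tmul s y : UniformSpace.Completion K.Pre)

theorem inner_elem (s s' : S) (y y' : Y) :
    inner C (K.elem s y) (K.elem s' y') = inner C y (K.toFun s s' y') :=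
  (completion_inner_coe (B := C) (K.tmul s y) (K.tmul s' y')).trans (K.inner_tmul s s' y y')

variable {K} in
/-- Two continuous linear maps on the completion agree if they agree on elementary tensors. -/
theorem clm_ext {Z : Type*} [NormedAddCommGroup Z] [NormedSpace ℂ Z] {f g : K.Space →L[ℂ] Z}
    (h : ∀ s y, f (K.elem s y) = g (K.elem s y)) : f = g := by
  refine ContinuousLinearMap.ext fun v => ?_
  refine UniformSpace.Completion.induction_on (α := K.Pre) v
    (isClosed_eq f.continuous g.continuous) fun v => ?_
  induction v using K.induction with
  | zero =>
    change f 0 = g 0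
    rw [map_zero, map_zero]
  | tmul s y => exact h s y
  | add u v hu hv =>
    rw [UniformSpace.Completion.coe_add]
    refine (f.map_add _ _).trans (Eq.trans ?_ (g.map_add _ _).symm)
    exact congrArg₂ (· + ·) hu hv

/-- The operator `L ⊗ 1` on the algebraic tensor product. -/
def preMap (L : S →ₗ[ℂ] S) : K.Pre →ₗ[ℂ] K.Pre :=
  (LinearMap.rTensor Y L : S ⊗[ℂ] Y →ₗ[ℂ] S ⊗[ℂ] Y)

/-- The extension of `L ⊗ 1` to the completion, for bounded `L ⊗ 1`. -/
def mapCLM (L : S →ₗ[ℂ] S) (hL : ∃ c : ℝ, ∀ v, ‖K.preMap L v‖ ≤ c * ‖v‖) :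
    K.Space →L[ℂ] K.Space :=
  ((K.preMap L).mkContinuousOfExistsBound hL).completion

theorem mapCLM_elem (L : S →ₗ[ℂ] S) (hL : ∃ c : ℝ, ∀ v, ‖K.preMap L v‖ ≤ c * ‖v‖) (s : S) (y : Y) :
    K.mapCLM L hL (K.elem s y) = K.elem (L s) y :=
  ContinuousLinearMap.completion_apply_coe _ _

theorem mapCLM_adjoint (L L' : S →ₗ[ℂ] S) (hL : ∃ c : ℝ, ∀ v, ‖K.preMap L v‖ ≤ c * ‖v‖)
    (hL' : ∃ c : ℝ, ∀ v, ‖K.preMap L' v‖ ≤ c * ‖v‖)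
    (h : ∀ s t, K.toFun (L s) t = K.toFun s (L' t)) (u v : K.Space) :
    inner C (K.mapCLM L hL u) v = inner C u (K.mapCLM L' hL' v) := by
  have hc : ∀ u v : K.Pre, inner C (K.preMap L u) v = inner C u (K.preMap L' v) := by
    intro u v
    induction u using K.induction with
    | zero => rw [map_zero, pre_inner_zero_left, pre_inner_zero_left]
    | add u u' hu hu' => rw [map_add, pre_inner_add_left, pre_inner_add_left, hu, hu']
    | tmul s y =>
      induction v using K.induction with
      | zero => rw [map_zero, pre_inner_zero_right, pre_inner_zero_right]
      | add u u' hu hu' => rw [map_add, pre_inner_add_right, pre_inner_add_right, hu, hu']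
      | tmul t z => exact congrArg (fun T : Adj C Y => inner C y (T z)) (h s t)
  refine UniformSpace.Completion.induction_on₂ (α := K.Pre) (β := K.Pre) u v
    (isClosed_eq ?_ ?_) fun u v => ?_
  · exact Continuous.cinner ((K.mapCLM L hL).continuous.comp continuous_fst) continuous_snd
  · exact Continuous.cinner continuous_fst ((K.mapCLM L' hL').continuous.comp continuous_snd)
  · have h1 : K.mapCLM L hL (u : UniformSpace.Completion K.Pre) =
      (K.preMap L u : UniformSpace.Completion K.Pre) := ContinuousLinearMap.completion_apply_coe _ _
    have h2 : K.mapCLM L' hL' (v : UniformSpace.Completion K.Pre) =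
      (K.preMap L' v : UniformSpace.Completion K.Pre) :=
      ContinuousLinearMap.completion_apply_coe _ _
    rw [h1, h2]
    exact (completion_inner_coe _ _).trans ((hc u v).trans (completion_inner_coe _ _).symm)

end PosKernel

end Kernel

namespace PosKernel

variable {C S Y : Type*} [NonUnitalCStarAlgebra C] [PartialOrder C]
    [StarOrderedRing C] [AddCommGroup S] [Module ℂ S] [NormedAddCommGroup Y] [NormedSpace ℂ Y]
    [SMul Cᵐᵒᵖ Y] [HilbertModule C Y] (K : PosKernel C S Y)

theorem preMap_bound (L : S →ₗ[ℂ] S) (c : ℝ) (hc : 0 ≤ c)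
    (h : ∀ v : K.Pre, inner C (K.preMap L v) (K.preMap L v) ≤ (c ^ 2) • inner C v v) :
    ∃ c : ℝ, ∀ v, ‖K.preMap L v‖ ≤ c * ‖v‖ := by
  refine ⟨c, fun v => ?_⟩
  refine abs_le_of_sq_le_sq' ?_ (by positivity) |>.2
  rw [mul_pow, SemiHilbertModule.norm_sq_eq (B := C), SemiHilbertModule.norm_sq_eq (B := C) v]
  refine (CStarAlgebra.norm_le_norm_of_nonneg_of_le
    (PreHilbertModule.cinner_self_nonneg _) (h v)).trans_eq ?_
  rw [norm_smul, Real.norm_of_nonneg (by positivity)]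

/-- The adjointable operator `L ⊗ 1` on the completion. -/
def mapAdj (L L' : S →ₗ[ℂ] S) (hL : ∃ c : ℝ, ∀ v, ‖K.preMap L v‖ ≤ c * ‖v‖)
    (hL' : ∃ c : ℝ, ∀ v, ‖K.preMap L' v‖ ≤ c * ‖v‖)
    (h : ∀ s t, K.toFun (L s) t = K.toFun s (L' t)) : Adj C K.Space :=
  Adj.mk (K.mapCLM L hL) (K.mapCLM L' hL') (K.mapCLM_adjoint L L' hL hL' h)

theorem star_mapAdj (L L' : S →ₗ[ℂ] S) (hL : ∃ c : ℝ, ∀ v, ‖K.preMap L v‖ ≤ c * ‖v‖)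
    (hL' : ∃ c : ℝ, ∀ v, ‖K.preMap L' v‖ ≤ c * ‖v‖)
    (h : ∀ s t, K.toFun (L s) t = K.toFun s (L' t)) :
    star (K.mapAdj L L' hL hL' h) = K.mapAdj L' L hL' hL (fun s t => by
      rw [← K.star_apply, ← h, K.star_apply]) :=
  Adj.star_eq_of _ _ (K.mapCLM_adjoint L L' hL hL' h)

variable {K} in
theorem adj_ext {T T' : Adj C K.Space} (h : ∀ s y, T (K.elem s y) = T' (K.elem s y)) : T = T' :=
  Adj.ext fun x => congrArg (fun f : K.Space →L[ℂ] K.Space => f x)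
    (clm_ext (f := T.toCLM) (g := T'.toCLM) h)

theorem elem_add (s t : S) (y : Y) : K.elem (s + t) y = K.elem s y + K.elem t y := by
  have : K.tmul (s + t) y = K.tmul s y + K.tmul t y := TensorProduct.add_tmul s t y
  exact (congrArg _ this).trans (UniformSpace.Completion.coe_add _ _)

theorem elem_smul (c : ℂ) (s : S) (y : Y) : K.elem (c • s) y = c • K.elem s y := by
  have : K.tmul (c • s) y = c • K.tmul s y := TensorProduct.smul_tmul' c s y
  exact (congrArg _ this).trans (UniformSpace.Completion.coe_smul _ _)

end PosKernel

/-! ### Positivity of the two kernels -/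

section Positivity

variable {A B X : Type*} [NonUnitalCStarAlgebra A] [PartialOrder A] [StarOrderedRing A]
  [NonUnitalCStarAlgebra B] [PartialOrder B] [StarOrderedRing B]
  [NormedAddCommGroup X] [NormedSpace ℂ X] [SMul Bᵐᵒᵖ X] [HilbertModule B X]

open PreHilbertModule SemiHilbertModule

theorem exists_star_mul_self {E : Type*} [NonUnitalCStarAlgebra E] [PartialOrder E]
    [StarOrderedRing E] {a : E} (ha : 0 ≤ a) : ∃ b, a = star b * b :=
  CStarAlgebra.nonneg_iff_eq_star_mul_self.mp ha

theorem star_mul_le_smul {E : Type*} [NonUnitalCStarAlgebra E] [PartialOrder E]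
    [StarOrderedRing E] (d r : E) (c : ℝ) (hd : ‖d‖ ≤ c) :
    star (d * r) * (d * r) ≤ ((c ^ 2 : ℝ) : ℂ) • (star r * r) := by
  rw [star_mul, mul_assoc, ← mul_assoc (star d), ← mul_assoc, Complex.coe_smul]
  refine (CStarAlgebra.star_left_conjugate_le_norm_smul (IsSelfAdjoint.star_mul_self d)).trans
    (smul_le_smul_of_nonneg_right ?_ (star_mul_self_nonneg r))
  rw [CStarRing.norm_star_mul_self, sq]
  exact mul_self_le_mul_self (norm_nonneg d) hd

theorem exists_negPart {E : Type*} [NonUnitalCStarAlgebra E] [PartialOrder E]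
    [StarOrderedRing E] (M : E) (hM : IsSelfAdjoint M) :
    ∃ N : E, 0 ≤ N ∧ M * N = -(N * N) ∧ (N = 0 → 0 ≤ M) := by
  refine ⟨M⁻, CFC.negPart_nonneg M, ?_, fun h => ?_⟩
  · have h : (M⁺ - M⁻) * M⁻ = -(M⁻ * M⁻) := by
      rw [sub_mul, CFC.posPart_mul_negPart, zero_sub]
    rwa [CFC.posPart_sub_negPart M hM] at h
  · exact CStarAlgebra.nonneg_iff_isSelfAdjoint_and_negPart_eq_zero.mpr ⟨hM, h⟩

theorem eq_zero_of_conj {E : Type*} [NonUnitalCStarAlgebra E] {N : E} (hNs : star N = N)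
    (h : N * N * N = 0) : N = 0 := by
  have h4 : star (N * N) * (N * N) = 0 := by
    rw [star_mul, hNs, ← mul_assoc, h, zero_mul]
  have h5 : star N * N = 0 := by rw [hNs]; exact CStarRing.star_mul_self_eq_zero_iff _ |>.mp h4
  exact CStarRing.star_mul_self_eq_zero_iff _ |>.mp h5

theorem Adj.sum_apply {ι : Type*} (s : Finset ι) (T : ι → Adj B X) (x : X) :
    (∑ i ∈ s, T i) x = ∑ i ∈ s, T i x := by
  classical
  induction s using Finset.induction_on with
  | empty => simp [Adj.zero_apply]
  | insert a s ha ih => rw [Finset.sum_insert ha, Finset.sum_insert ha, Adj.add_apply, ih]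

theorem matrix_pos {n : ℕ} (M : CStarMatrix (Fin n) (Fin n) (Adj B X)) (hM : 0 ≤ M)
    (x : Fin n → X) : 0 ≤ ∑ i, ∑ j, inner B (x i) (M i j (x j)) := by
  obtain ⟨N, rfl⟩ := exists_star_mul_self hM
  have h : ∑ i, ∑ j, inner B (x i) ((star N * N) i j (x j)) =
      ∑ k, inner B (∑ i, N k i (x i)) (∑ j, N k j (x j)) := by
    have h1 : ∀ i j, inner B (x i) ((star N * N) i j (x j)) =
        ∑ k, inner B (N k i (x i)) (N k j (x j)) := fun i j => by
      simp only [CStarMatrix.mul_apply, CStarMatrix.star_apply, Adj.sum_apply, Adj.mul_apply,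
        cinner_sum_right, Adj.inner_star_right]
    simp only [h1, cinner_sum_left, cinner_sum_right]
    rw [Finset.sum_comm]
    conv_rhs => rw [Finset.sum_comm]
    refine Finset.sum_congr rfl fun j _ => ?_
    rw [Finset.sum_comm]
  rw [h]
  exact Finset.sum_nonneg fun k _ => cinner_self_nonneg _

theorem cp_pos (ρ : A →CP Adj B X) {n : ℕ} (M : CStarMatrix (Fin n) (Fin n) A) (hM : 0 ≤ M)
    (m : Fin n → Fin n → A) (hm : ∀ i j, M i j = n • m i j) (x : Fin n → X) :
    0 ≤ ∑ i, ∑ j, inner B (x i) (ρ (m i j) (x j)) := by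
  rcases Nat.eq_zero_or_pos n with rfl | hn
  · simp
  have h := matrix_pos (M.map ρ) (ρ.map_cstarMatrix_nonneg' n M hM) x
  have hn' : (n : ℂ) ≠ 0 := by exact_mod_cast hn.ne'
  have h1 : ∀ i j, inner B (x i) (ρ (m i j) (x j)) =
      (n : ℝ)⁻¹ • inner B (x i) ((M.map ρ) i j (x j)) := by
    intro i j
    rw [CStarMatrix.map_apply, hm, ← Nat.cast_smul_eq_nsmul ℂ, map_smul, Adj.smul_apply,
      cinner_smul_right, ← Complex.coe_smul, smul_smul]
    simp [hn']
  simp only [h1, ← Finset.smul_sum]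
  exact smul_nonneg (by positivity) h

/-- The matrix all of whose rows are `(a₁, …, aₙ)`. -/
def rowMatrix {n : ℕ} (a : Fin n → A) : CStarMatrix (Fin n) (Fin n) A :=
  CStarMatrix.ofMatrix fun _ j => a j

theorem rowMatrix_apply {n : ℕ} (a : Fin n → A) (i j : Fin n) : rowMatrix a i j = a j := rfl

theorem star_rowMatrix_mul {n : ℕ} (a : Fin n → A) (i j : Fin n) :
    (star (rowMatrix a) * rowMatrix a) i j = n • (star (a i) * a j) := by
  simp [CStarMatrix.mul_apply, CStarMatrix.star_apply, rowMatrix_apply]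

theorem cp_gram (ρ : A →CP Adj B X) (n : ℕ) (a : Fin n → A) (x : Fin n → X) :
    0 ≤ ∑ i, ∑ j, inner B (x i) (ρ (star (a i) * a j) (x j)) :=
  cp_pos ρ _ (star_mul_self_nonneg (rowMatrix a)) _ (star_rowMatrix_mul a) x

/-- The diagonal embedding `A → M_n(A)`. -/
def diagHom (n : ℕ) : A →⋆ₙₐ[ℂ] CStarMatrix (Fin n) (Fin n) A where
  toFun a := CStarMatrix.ofMatrix (Matrix.diagonal fun _ => a)
  map_smul' c a := by
    ext i j; by_cases h : i = j <;> simp [Matrix.diagonal, h]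
  map_zero' := by
    ext i j; by_cases h : i = j <;> simp [Matrix.diagonal, h]
  map_add' a b := by
    ext i j; by_cases h : i = j <;> simp [Matrix.diagonal, h]
  map_mul' a b := by
    ext i j; by_cases h : i = j <;> simp [Matrix.diagonal, CStarMatrix.mul_apply, h]
  map_star' a := by
    ext i j
    by_cases h : i = j
    · simp [Matrix.diagonal, CStarMatrix.star_apply, h]
    · simp [Matrix.diagonal, CStarMatrix.star_apply, h, Ne.symm h]

theorem cp_gram_le (ρ : A →CP Adj B X) (b : A) (n : ℕ) (a : Fin n → A) (x : Fin n → X) :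
    ∑ i, ∑ j, inner B (x i) (ρ (star (b * a i) * (b * a j)) (x j)) ≤
      (‖b‖ ^ 2) • ∑ i, ∑ j, inner B (x i) (ρ (star (a i) * a j) (x j)) := by
  have hD : diagHom n b * rowMatrix a = rowMatrix fun i => b * a i := by
    ext i j
    simp [CStarMatrix.mul_apply, rowMatrix_apply, diagHom, Matrix.diagonal]
  have hle : star (rowMatrix fun i => b * a i) * (rowMatrix fun i => b * a i) ≤
      ((‖b‖ ^ 2 : ℝ) : ℂ) • (star (rowMatrix a) * rowMatrix a) := by
    rw [← hD]
    exact star_mul_le_smul _ _ _ (NonUnitalStarAlgHom.norm_apply_le (diagHom n) b)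
  have h := cp_pos ρ _ (sub_nonneg.mpr hle)
    (fun i j => ((‖b‖ ^ 2 : ℝ) : ℂ) • (star (a i) * a j) - star (b * a i) * (b * a j)) (fun i j => by
      rw [CStarMatrix.sub_apply, CStarMatrix.smul_apply, star_rowMatrix_mul, star_rowMatrix_mul,
        smul_sub, smul_comm]) x
  rw [← sub_nonneg]
  convert h using 1
  rw [Finset.smul_sum, ← Finset.sum_sub_distrib]
  refine Finset.sum_congr rfl fun i _ => ?_
  rw [Finset.smul_sum, ← Finset.sum_sub_distrib]
  refine Finset.sum_congr rfl fun j _ => ?_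
  rw [map_sub, Adj.sub_apply, cinner_sub_right, map_smul, Adj.smul_apply, cinner_smul_right,
    Complex.coe_smul]

theorem matrix_nonneg_of_forall {n : ℕ} (M : CStarMatrix (Fin n) (Fin n) B)
    (hM : IsSelfAdjoint M)
    (h : ∀ b : Fin n → B, 0 ≤ ∑ i, ∑ j, star (b i) * M i j * b j) : 0 ≤ M := by
  obtain ⟨N, hN0, hMN, hN⟩ := exists_negPart M hM
  refine hN ?_
  have hNs : star N = N := (IsSelfAdjoint.of_nonneg hN0).star_eq
  have hpos : 0 ≤ star N * N * N := star_left_conjugate_nonneg hN0 N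
  obtain ⟨L, hL⟩ := exists_star_mul_self hpos
  have hdiag : ∀ k, (star L * L) k k ≤ 0 := by
    intro k
    have h1 := h fun i => N i k
    have h2 : ∑ i, ∑ j, star (N i k) * M i j * N j k = (star N * (M * N)) k k := by
      simp only [CStarMatrix.mul_apply, CStarMatrix.star_apply, Finset.mul_sum, mul_assoc]
    rw [h2, hMN, mul_neg, ← mul_assoc, hNs] at h1
    rw [← hL, hNs]
    simpa using h1
  have hL0 : L = 0 := by
    ext i k
    have h1 := hdiag k
    simp only [CStarMatrix.mul_apply, CStarMatrix.star_apply] at h1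
    have h2 := (Finset.sum_nonneg fun i _ => star_mul_self_nonneg (L i k)).antisymm' h1
    rw [Finset.sum_eq_zero_iff_of_nonneg fun i _ => star_mul_self_nonneg (L i k)] at h2
    simpa using h2 i (Finset.mem_univ i)
  rw [hL0, mul_zero, hNs] at hL
  exact eq_zero_of_conj hNs hL

/-- The Gram matrix of vectors in a Hilbert module is positive. -/
theorem gram_nonneg (n : ℕ) (x : Fin n → X) :
    0 ≤ (CStarMatrix.ofMatrix fun i j => inner B (x i) (x j) :
      CStarMatrix (Fin n) (Fin n) B) := by
  refine matrix_nonneg_of_forall _ ?_ fun b => ?_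
  · ext i j
    rw [CStarMatrix.star_apply]
    exact star_cinner _ _
  · have h := cinner_self_nonneg (B := B) (∑ i, MulOpposite.op (b i) • x i)
    simp only [cinner_sum_left, cinner_sum_right, cinner_op_smul_left,
      cinner_op_smul_right, Finset.sum_mul] at h
    rw [Finset.sum_comm] at h
    exact h

end Positivity

/-! ### The KSGNS correspondence -/

section KSGNS

variable {A B X : Type*} [NonUnitalCStarAlgebra A] [PartialOrder A] [StarOrderedRing A]
  [NonUnitalCStarAlgebra B] [PartialOrder B] [StarOrderedRing B]
  [NormedAddCommGroup X] [NormedSpace ℂ X] [SMul Bᵐᵒᵖ X] [HilbertModule B X]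

theorem cp_map_star (ρ : A →CP Adj B X) (a : A) : ρ (star a) = star (ρ a) :=
  map_star ρ a

/-- The kernel `(a, a') ↦ ρ(a* a')` of a completely positive map. -/
def ksgnsKernel (ρ : A →CP Adj B X) : PosKernel B A X where
  toFun := LinearMap.mk₂'ₛₗ (starRingEnd ℂ) (RingHom.id ℂ) (fun a a' => ρ (star a * a'))
    (fun a b c => by rw [star_add, add_mul, map_add])
    (fun c a b => by rw [star_smul, smul_mul_assoc, map_smul]; rfl)
    (fun a b c => by rw [mul_add, map_add])
    (fun c a b => by rw [mul_smul_comm, map_smul]; rfl)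
  star_apply a b := by
    simp only [LinearMap.mk₂'ₛₗ_apply]
    rw [← cp_map_star, star_mul, star_star]
  pos n a x := cp_gram ρ n a x

/-- The KSGNS space `A ⊗_ρ X`: the completion of `A ⊗_ℂ X` (modulo null vectors) for
`⟨a ⊗ x, a' ⊗ x'⟩ = ⟨x, ρ(a* a') x'⟩`. -/
abbrev KSGNS (ρ : A →CP Adj B X) : Type _ := (ksgnsKernel ρ).Space

theorem ksgns_bound (ρ : A →CP Adj B X) (b : A) :
    ∃ c : ℝ, ∀ v, ‖(ksgnsKernel ρ).preMap (LinearMap.mulLeft ℂ b) v‖ ≤ c * ‖v‖ := by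
  refine (ksgnsKernel ρ).preMap_bound _ ‖b‖ (norm_nonneg b) fun v => ?_
  obtain ⟨n, a, x, rfl⟩ := TensorProduct.exists_sum_tmul_eq (R := ℂ) (M := A) (N := X) v
  have key : ∀ a : Fin n → A, (ksgnsKernel ρ).form (∑ j, a j ⊗ₜ[ℂ] x j) (∑ j, a j ⊗ₜ[ℂ] x j) =
      ∑ i, ∑ j, inner B (x i) (ρ (star (a i) * a j) (x j)) := by
    intro a
    rw [LinearMap.map_sum₂]
    refine Finset.sum_congr rfl fun i _ => ?_
    rw [map_sum]
    rfl
  have h1 : (ksgnsKernel ρ).preMap (LinearMap.mulLeft ℂ b)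
      (show (ksgnsKernel ρ).Pre from ∑ j, a j ⊗ₜ[ℂ] x j) =
      (show (ksgnsKernel ρ).Pre from ∑ j, (b * a j) ⊗ₜ[ℂ] x j) := by
    refine (map_sum (LinearMap.rTensor X (LinearMap.mulLeft ℂ b)) _ _).trans ?_
    rfl
  have h2 := cp_gram_le ρ b n a x
  rw [← key a] at h2
  exact (le_of_eq ((congrArg (fun w : (ksgnsKernel ρ).Pre => inner B w w) h1).trans
    (key fun j => b * a j))).trans h2

/-- The operator `a ⊗ x ↦ b a ⊗ x` on the KSGNS space. -/
def ksgnsOp (ρ : A →CP Adj B X) (b : A) : Adj B (KSGNS ρ) :=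
  (ksgnsKernel ρ).mapAdj (LinearMap.mulLeft ℂ b) (LinearMap.mulLeft ℂ (star b))
    (ksgns_bound ρ b) (ksgns_bound ρ (star b)) fun s t => by
      change ρ (star (b * s) * t) = ρ (star s * (star b * t))
      rw [star_mul, mul_assoc]

theorem ksgnsOp_elem (ρ : A →CP Adj B X) (b a : A) (x : X) :
    ksgnsOp ρ b ((ksgnsKernel ρ).elem a x) = (ksgnsKernel ρ).elem (b * a) x :=
  PosKernel.mapCLM_elem _ _ _ a x

theorem star_ksgnsOp (ρ : A →CP Adj B X) (b : A) : star (ksgnsOp ρ b) = ksgnsOp ρ (star b) := by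
  refine (PosKernel.star_mapAdj _ _ _ _ _ _).trans (PosKernel.adj_ext fun a x => ?_)
  rw [ksgnsOp_elem]
  exact PosKernel.mapCLM_elem _ _ _ a x

/-- The left action `π_ρ(a') (a ⊗ x) = a' a ⊗ x` on the KSGNS space. -/
def ksgnsAction (ρ : A →CP Adj B X) : A →⋆ₙₐ[ℂ] Adj B (KSGNS ρ) where
  toFun := ksgnsOp ρ
  map_smul' c b := PosKernel.adj_ext fun a x => by
    rw [ksgnsOp_elem, Adj.smul_apply, MonoidHom.id_apply, ksgnsOp_elem, smul_mul_assoc,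
      PosKernel.elem_smul]
  map_zero' := PosKernel.adj_ext fun a x => by
    have h := (ksgnsKernel ρ).elem_smul 0 (0 : A) x
    rw [zero_smul, zero_smul] at h
    rw [ksgnsOp_elem, Adj.zero_apply, zero_mul, h]
  map_add' b c := PosKernel.adj_ext fun a x => by
    rw [ksgnsOp_elem, Adj.add_apply, ksgnsOp_elem, ksgnsOp_elem, add_mul, PosKernel.elem_add]
  map_mul' b c := PosKernel.adj_ext fun a x => by
    rw [ksgnsOp_elem, Adj.mul_apply, ksgnsOp_elem, ksgnsOp_elem, mul_assoc]
  map_star' b := (star_ksgnsOp ρ b).symm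

theorem ksgnsAction_elem (ρ : A →CP Adj B X) (b a : A) (x : X) :
    ksgnsAction ρ b ((ksgnsKernel ρ).elem a x) = (ksgnsKernel ρ).elem (b * a) x :=
  ksgnsOp_elem ρ b a x

end KSGNS

/-! ### The interior tensor product -/

section Interior

variable {B C X Y : Type*} [NonUnitalCStarAlgebra B] [PartialOrder B] [StarOrderedRing B]
  [NonUnitalCStarAlgebra C] [PartialOrder C] [StarOrderedRing C]
  [NormedAddCommGroup X] [NormedSpace ℂ X] [SMul Bᵐᵒᵖ X] [HilbertModule B X]
  [NormedAddCommGroup Y] [NormedSpace ℂ Y] [SMul Cᵐᵒᵖ Y] [HilbertModule C Y]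

open PreHilbertModule

theorem hom_add {E : Type*} [NonUnitalCStarAlgebra E] (φ : B →⋆ₙₐ[ℂ] E) (a b : B) : φ (a + b) = φ a + φ b := map_add φ a b

theorem hom_smul {E : Type*} [NonUnitalCStarAlgebra E] (φ : B →⋆ₙₐ[ℂ] E) (c : ℂ) (b : B) : φ (c • b) = c • φ b := map_smul φ c b

theorem hom_star (φ : B →⋆ₙₐ[ℂ] Adj C Y) (b : B) : φ (star b) = star (φ b) := map_star φ b

theorem hom_cp {E F : Type*} [NonUnitalCStarAlgebra E] [PartialOrder E] [StarOrderedRing E]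
    [NonUnitalCStarAlgebra F] [PartialOrder F] [StarOrderedRing F] (φ : E →⋆ₙₐ[ℂ] F) (n : ℕ)
    (M : CStarMatrix (Fin n) (Fin n) E) (hM : 0 ≤ M) : 0 ≤ M.map φ :=
  CompletelyPositiveMapClass.map_cstarMatrix_nonneg' φ n M hM

variable (X) in
/-- The kernel `(x, x') ↦ φ(⟨x, x'⟩)` of a left action `φ : B → End_C(Y)`. -/
def tensorKernel (φ : B →⋆ₙₐ[ℂ] Adj C Y) : PosKernel C X Y where
  toFun := LinearMap.mk₂'ₛₗ (starRingEnd ℂ) (RingHom.id ℂ) (fun x x' => φ (inner B x x'))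
    (fun a b c => (congrArg φ (cinner_add_left a b c)).trans (hom_add φ _ _))
    (fun c a b => (congrArg φ (cinner_smul_left c a b)).trans (hom_smul φ _ _))
    (fun a b c => (congrArg φ (cinner_add_right a b c)).trans (hom_add φ _ _))
    (fun c a b => (congrArg φ (cinner_smul_right c a b)).trans (hom_smul φ _ _))
  star_apply a b := by
    simp only [LinearMap.mk₂'ₛₗ_apply]
    rw [← hom_star, star_cinner]
  pos n x y := matrix_pos _ (hom_cp φ n _ (gram_nonneg n x)) y

variable (X) in
/-- The interior tensor product `X ⊗_B Y`: the completion of `X ⊗_ℂ Y` (modulo null vectors) for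
`⟨x ⊗ y, x' ⊗ y'⟩ = ⟨y, φ(⟨x, x'⟩) y'⟩`. (The null vectors contain the balancing relations
`x b ⊗ y - x ⊗ φ(b) y`.) -/
abbrev Interior (φ : B →⋆ₙₐ[ℂ] Adj C Y) : Type _ := (tensorKernel X φ).Space

theorem interior_bound (φ : B →⋆ₙₐ[ℂ] Adj C Y) (T : Adj B X) :
    ∃ c : ℝ, ∀ v, ‖(tensorKernel X φ).preMap T.toCLM v‖ ≤ c * ‖v‖ := by
  refine (tensorKernel X φ).preMap_bound _ ‖T‖ (norm_nonneg T) fun v => ?_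
  obtain ⟨S, hS⟩ := exists_star_mul_self
    (sub_nonneg.mpr (CStarAlgebra.star_mul_le_algebraMap_norm_sq (a := T)))
  have hTS : ∀ x x' : X, inner B (T x) (T x') + inner B (S x) (S x') =
      ((‖T‖ ^ 2 : ℝ) : ℂ) • inner B x x' := by
    intro x x'
    rw [← Adj.inner_star_right T, ← Adj.inner_star_right S, ← cinner_add_right,
      ← cinner_smul_right]
    have h := congrArg (fun R : Adj B X => R x') (add_eq_of_eq_sub' hS.symm)
    rw [Algebra.algebraMap_eq_smul_one, ← Complex.coe_smul] at h
    exact congrArg _ h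
  have key : ∀ u v : (tensorKernel X φ).Pre,
      inner C ((tensorKernel X φ).preMap T.toCLM u) ((tensorKernel X φ).preMap T.toCLM v) +
      inner C ((tensorKernel X φ).preMap S.toCLM u) ((tensorKernel X φ).preMap S.toCLM v) =
        ((‖T‖ ^ 2 : ℝ) : ℂ) • inner C u v := by
    intro u v
    induction u using (tensorKernel X φ).induction with
    | zero => simp only [map_zero, cinner_zero_left, smul_zero, add_zero]
    | add u u' hu hu' =>
      simp only [map_add, cinner_add_left, smul_add]
      rw [← hu, ← hu']; abel
    | tmul s y =>
      induction v using (tensorKernel X φ).induction with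
      | zero => simp only [map_zero, cinner_zero_right, smul_zero, add_zero]
      | add u u' hu hu' =>
        simp only [map_add, cinner_add_right, smul_add]
        rw [← hu, ← hu']; abel
      | tmul t z =>
        change inner C y (φ (inner B (T s) (T t)) z) + inner C y (φ (inner B (S s) (S t)) z) =
          _ • inner C y (φ (inner B s t) z)
        rw [← cinner_add_right, ← Adj.add_apply, ← hom_add, hTS, hom_smul, Adj.smul_apply,
          cinner_smul_right]
  rw [← Complex.coe_smul]
  exact (le_add_of_nonneg_right (cinner_self_nonneg _)).trans_eq (key v v)

/-- The operator `x ⊗ y ↦ T x ⊗ y` on the interior tensor product. -/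
def amplifyOp (φ : B →⋆ₙₐ[ℂ] Adj C Y) (T : Adj B X) : Adj C (Interior X φ) :=
  (tensorKernel X φ).mapAdj T.toCLM (star T).toCLM
    (interior_bound φ T) (interior_bound φ (star T)) fun s t =>
      congrArg φ (Adj.inner_star_right T s t).symm

theorem amplifyOp_elem (φ : B →⋆ₙₐ[ℂ] Adj C Y) (T : Adj B X) (x : X) (y : Y) :
    amplifyOp φ T ((tensorKernel X φ).elem x y) = (tensorKernel X φ).elem (T x) y :=
  PosKernel.mapCLM_elem _ _ _ x y

theorem star_amplifyOp (φ : B →⋆ₙₐ[ℂ] Adj C Y) (T : Adj B X) :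
    star (amplifyOp φ T) = amplifyOp φ (star T) := by
  refine (PosKernel.star_mapAdj _ _ _ _ _ _).trans (PosKernel.adj_ext fun x y => ?_)
  rw [amplifyOp_elem]
  exact PosKernel.mapCLM_elem _ _ _ x y

variable (X) in
/-- The `*`-homomorphism `T ↦ T ⊗ Id_Y` from `End_B(X)` to `End_C(X ⊗_B Y)`. -/
def amplify (φ : B →⋆ₙₐ[ℂ] Adj C Y) : Adj B X →⋆ₙₐ[ℂ] Adj C (Interior X φ) where
  toFun := amplifyOp φ
  map_smul' c T := PosKernel.adj_ext fun x y => by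
    rw [amplifyOp_elem, Adj.smul_apply, MonoidHom.id_apply, Adj.smul_apply, amplifyOp_elem,
      PosKernel.elem_smul]
  map_zero' := PosKernel.adj_ext fun x y => by
    have h := (tensorKernel X φ).elem_smul 0 (0 : X) y
    rw [zero_smul, zero_smul] at h
    rw [amplifyOp_elem, Adj.zero_apply, Adj.zero_apply, h]
  map_add' S T := PosKernel.adj_ext fun x y => by
    rw [amplifyOp_elem, Adj.add_apply, Adj.add_apply, amplifyOp_elem, amplifyOp_elem,
      PosKernel.elem_add]
  map_mul' S T := PosKernel.adj_ext fun x y => by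
    rw [amplifyOp_elem, Adj.mul_apply, Adj.mul_apply, amplifyOp_elem, amplifyOp_elem]
  map_star' T := (star_amplifyOp φ T).symm

theorem amplify_elem (φ : B →⋆ₙₐ[ℂ] Adj C Y) (T : Adj B X) (x : X) (y : Y) :
    amplify X φ T ((tensorKernel X φ).elem x y) = (tensorKernel X φ).elem (T x) y :=
  amplifyOp_elem φ T x y

end Interior

/-! ### Positive correspondences -/

section Positive

variable {A B C X Y : Type*} [NonUnitalCStarAlgebra A] [PartialOrder A] [StarOrderedRing A]
  [NonUnitalCStarAlgebra B] [PartialOrder B] [StarOrderedRing B]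
  [NonUnitalCStarAlgebra C] [PartialOrder C] [StarOrderedRing C]
  [NormedAddCommGroup X] [NormedSpace ℂ X] [SMul Bᵐᵒᵖ X] [HilbertModule B X]
  [NormedAddCommGroup Y] [NormedSpace ℂ Y] [SMul Cᵐᵒᵖ Y] [HilbertModule C Y]

/-- A completely positive map `ρ : A → End_B(X)` is strict if `(ρ(aᵢ))` is strictly Cauchy, i.e.
`(ρ(aᵢ) x)` and `(ρ(aᵢ)* x)` are Cauchy in `X` for all `x`, for some approximate unit `(aᵢ)` of `A`
of positive contractions. The approximate unit is given as a filter on `A`. -/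
def IsStrict (ρ : A →CP Adj B X) : Prop :=
  ∃ l : Filter A, l.IsIncreasingApproximateUnit ∧
    (∀ x, Cauchy (l.map fun a => ρ a x)) ∧ ∀ x, Cauchy (l.map fun a => star (ρ a) x)

/-- The completely positive map `ρ ⊗ Id : a ↦ ρ(a) ⊗ Id_Y` from `A` to `End_C(X ⊗_B Y)`. -/
def tensorId (ρ : A →CP Adj B X) (φ : B →⋆ₙₐ[ℂ] Adj C Y) : A →CP Adj C (Interior X φ) where
  toFun a := amplify X φ (ρ a)
  map_add' a b := by rw [map_add ρ, hom_add]
  map_smul' c a := by rw [map_smul ρ, hom_smul]; rfl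
  map_cstarMatrix_nonneg' k M hM :=
    hom_cp (amplify X φ) k _ (ρ.map_cstarMatrix_nonneg' k M hM)

/-- The composition `(ρ, X) ⊗ (σ, Y) = (ρ ⊗ Id, X ⊗_B (B ⊗_σ Y))` of positive correspondences,
where `B` acts on the KSGNS space `B ⊗_σ Y` by `π_σ`. -/
def compose (ρ : A →CP Adj B X) (σ : B →CP Adj C Y) : A →CP Adj C (Interior X (ksgnsAction σ)) :=
  tensorId ρ (ksgnsAction σ)

end Positive

section Iso

/-- Isomorphism of `A`-`B`-correspondences, for left actions `ρ : A → End_B(X)` and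
`σ : A → End_B(Y)`: an adjointable unitary `U : X → Y`, with adjoint `V`, such that
`U ρ(a) U* = σ(a)` for all `a`. -/
def CorrIso {A B X Y : Type*} [NonUnitalCStarAlgebra B] [PartialOrder B] [StarOrderedRing B]
    [NormedAddCommGroup X] [NormedSpace ℂ X] [SMul Bᵐᵒᵖ X] [HilbertModule B X]
    [NormedAddCommGroup Y] [NormedSpace ℂ Y] [SMul Bᵐᵒᵖ Y] [HilbertModule B Y]
    (ρ : A → Adj B X) (σ : A → Adj B Y) : Prop :=
  ∃ (U : X →L[ℂ] Y) (V : Y →L[ℂ] X), (∀ x y, inner B (U x) y = inner B x (V y)) ∧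
    (∀ x, V (U x) = x) ∧ (∀ y, U (V y) = y) ∧ ∀ a y, U (ρ a (V y)) = σ a y

variable {A B X Y Z : Type*} [NonUnitalCStarAlgebra B] [PartialOrder B] [StarOrderedRing B]
    [NormedAddCommGroup X] [NormedSpace ℂ X] [SMul Bᵐᵒᵖ X] [HilbertModule B X]
    [NormedAddCommGroup Y] [NormedSpace ℂ Y] [SMul Bᵐᵒᵖ Y] [HilbertModule B Y]
    [NormedAddCommGroup Z] [NormedSpace ℂ Z] [SMul Bᵐᵒᵖ Z] [HilbertModule B Z]

open PreHilbertModule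

theorem CorrIso.refl (ρ : A → Adj B X) : CorrIso ρ ρ :=
  ⟨.id ℂ X, .id ℂ X, fun _ _ => rfl, fun _ => rfl, fun _ => rfl, fun _ _ => rfl⟩

theorem CorrIso.symm {ρ : A → Adj B X} {σ : A → Adj B Y} (h : CorrIso ρ σ) : CorrIso σ ρ := by
  obtain ⟨U, V, h1, h2, h3, h4⟩ := h
  refine ⟨V, U, fun y x => ?_, h3, h2, fun a x => ?_⟩
  · rw [← star_cinner, ← h1, star_cinner]
  · rw [← h4, h2, h2]

theorem CorrIso.trans {ρ : A → Adj B X} {σ : A → Adj B Y} {τ : A → Adj B Z}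
    (h : CorrIso ρ σ) (h' : CorrIso σ τ) : CorrIso ρ τ := by
  obtain ⟨U, V, h1, h2, h3, h4⟩ := h
  obtain ⟨U', V', h1', h2', h3', h4'⟩ := h'
  refine ⟨U'.comp U, V.comp V', fun x z => ?_, fun x => ?_, fun z => ?_, fun a z => ?_⟩
  · simp only [ContinuousLinearMap.comp_apply, h1', h1]
  · simp only [ContinuousLinearMap.comp_apply, h2', h2]
  · simp only [ContinuousLinearMap.comp_apply, h3, h3']
  · simp only [ContinuousLinearMap.comp_apply, h4, h4']

end Iso

/-! ### Isomorphism classes -/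

/-- A C*-algebra (not necessarily unital), bundled, with its order. -/
structure CAlg where
  carrier : Type u
  [alg : NonUnitalCStarAlgebra carrier]
  [order : PartialOrder carrier]
  [ordered : StarOrderedRing carrier]

instance : CoeSort CAlg.{u} (Type u) := ⟨CAlg.carrier⟩

attribute [instance] CAlg.alg CAlg.order CAlg.ordered

/-- A strict positive `A`-`B`-correspondence `(ρ, X)`, bundled. -/
structure StrictCorr (A B : CAlg.{u}) where
  carrier : Type u
  [group : NormedAddCommGroup carrier]
  [space : NormedSpace ℂ carrier]
  [smul : SMul Bᵐᵒᵖ carrier]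
  [hilbert : HilbertModule B carrier]
  map : A →CP Adj B carrier
  strict : IsStrict map

attribute [instance] StrictCorr.group StrictCorr.space StrictCorr.smul StrictCorr.hilbert

/-- Isomorphism of strict positive correspondences. -/
instance StrictCorr.setoid (A B : CAlg.{u}) : Setoid (StrictCorr A B) where
  r E F := CorrIso E.map F.map
  iseqv := ⟨fun _ => .refl _, .symm, .trans⟩

/-- The isomorphism classes of strict positive `A`-`B`-correspondences. -/
def IsoClass (A B : CAlg.{u}) : Type (u + 1) := Quotient (StrictCorr.setoid A B)

/-- The isomorphism class of a strict positive correspondence. -/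
def StrictCorr.isoClass {A B : CAlg.{u}} (E : StrictCorr A B) : IsoClass A B :=
  Quotient.mk (StrictCorr.setoid A B) E

end CStarCorr

end

open CStarCorr

noncomputable section

namespace CStarCorr

/-! ### Total families in normed spaces. -/

section Total

/-! Every module in the theorem is a completion generated by elementary tensors, and its inner
product on those tensors is given by an explicit formula. A Hilbert module is determined up to
unitary equivalence by the Gram matrix of a total family: if two total families `e` and `f` over the
same index set have equal Gram matrices, then sending `∑ c i • e i` to `∑ c i • f i` is well defined
and isometric, and it extends to a unitary. If the left actions also permute both families by the
same maps of the index set, the unitary intertwines them. This is `corrIso_of_total`, and every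
isomorphism below is an instance of it.

For `(A ⊗_ρ X) ⊗_B Y` and `A ⊗_{ρ ⊗ Id} (X ⊗_B Y)` the common Gram matrix is `⟨y, φ(⟨x, ρ(a* a')
x'⟩) y'⟩`. For associativity, with `w` in the KSGNS space of `τ`, it is `⟨w, π_τ(⟨y, σ(b* ⟨x, x'⟩
b') y'⟩) w'⟩`. Invariance under isomorphism is the same computation with the unitaries inserted.
What remains is totality of iterated elementary tensors, which follows from continuity of `s ⊗ y` in
each variable separately (`PosKernel.total_elem_right`, `total_tensor_elem`).

Strictness of `ρ ⊗ Id` is witnessed by the approximate unit of `ρ`. On `x ⊗ y` the Cauchy property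
comes from that of `ρ(aᵢ) x`, and it passes to the whole module because the operators are uniformly
bounded along the approximate unit (`cauchy_map_of_total`). -/

/-- A family of vectors is total if no proper closed subspace contains it. -/
def Total {ι E : Type*} [NormedAddCommGroup E] [NormedSpace ℂ E] (e : ι → E) : Prop :=
  ∀ M : Submodule ℂ E, IsClosed (M : Set E) → (∀ i, e i ∈ M) → ∀ x, x ∈ M

theorem total_of_surjective {ι E : Type*} [NormedAddCommGroup E] [NormedSpace ℂ E] {e : ι → E}
    (he : Function.Surjective e) : Total e := fun M _ h x => by
  obtain ⟨i, rfl⟩ := he x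
  exact h i

/-- Totality is tested on the closure of the span. The density form is what extension by continuity
needs. -/
theorem Total.denseRange {ι E : Type*} [NormedAddCommGroup E] [NormedSpace ℂ E] {e : ι → E}
    (he : Total e) : DenseRange (Finsupp.linearCombination ℂ e) := by
  intro x
  have h := he (LinearMap.range (Finsupp.linearCombination ℂ e)).topologicalClosure
    (Submodule.isClosed_topologicalClosure _)
    (fun i => Submodule.le_topologicalClosure _ ⟨Finsupp.single i 1, by simp⟩) x
  exact h

end Total

/-! ### Unitaries from equal Gram matrices. -/

section Unitary

variable {A B E F ι : Type*} [NonUnitalCStarAlgebra B] [PartialOrder B] [StarOrderedRing B]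
  [NormedAddCommGroup E] [NormedSpace ℂ E] [SMul Bᵐᵒᵖ E] [HilbertModule B E]
  [NormedAddCommGroup F] [NormedSpace ℂ F] [SMul Bᵐᵒᵖ F] [HilbertModule B F]
  {e : ι → E} {f : ι → F}

open PreHilbertModule SemiHilbertModule Finsupp

theorem cinner_linearCombination (h : ∀ i j, inner B (e i) (e j) = inner B (f i) (f j))
    (c d : ι →₀ ℂ) :
    inner B (linearCombination ℂ e c) (linearCombination ℂ e d) =
      inner B (linearCombination ℂ f c) (linearCombination ℂ f d) := by
  simp only [linearCombination_apply, Finsupp.sum, cinner_sum_left, cinner_sum_right,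
    cinner_smul_left, cinner_smul_right, h]

theorem norm_eq_of_cinner {x : E} {y : F} (h : inner B x x = inner B y y) : ‖x‖ = ‖y‖ := by
  have := norm_sq_eq (B := B) x
  rw [h, ← norm_sq_eq (B := B) y] at this
  exact (pow_left_inj₀ (norm_nonneg _) (norm_nonneg _) two_ne_zero).mp this

/-- A family with the same Gram matrix as a total family is its image under a bounded operator that
preserves inner products. -/
theorem exists_isometry (he : Total e) (h : ∀ i j, inner B (e i) (e j) = inner B (f i) (f j)) :
    ∃ U : E →L[ℂ] F, (∀ i, U (e i) = f i) ∧ ∀ x y, inner B (U x) (U y) = inner B x y := by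
  have : CompleteSpace F := HilbertModule.complete B
  -- Equality holds with constant 1, because the Gram matrix determines the norm of a combination.
  -- The bound also makes the assignment well defined: a combination of the `e i` that vanishes has
  -- a vanishing counterpart in the `f i`.
  have hn : ∃ C : ℝ, ∀ c, ‖linearCombination ℂ f c‖ ≤ C * ‖linearCombination ℂ e c‖ :=
    ⟨1, fun c => by
      rw [one_mul, norm_eq_of_cinner (cinner_linearCombination h c c)]⟩
  have hU := LinearMap.extendOfNorm_eq (f := linearCombination ℂ f) he.denseRange hn
  set U := (linearCombination ℂ f).extendOfNorm (linearCombination ℂ e)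
  refine ⟨U, fun i => by simpa using hU (single i 1), fun x y => ?_⟩
  -- Preservation of inner products is a closed condition on pairs, so finite linear combinations
  -- suffice.
  refine he.denseRange.induction_on₂ (p := fun x y => inner B (U x) (U y) = inner B x y)
    (isClosed_eq ?_ continuous_cinner) (fun c d => ?_) x y
  · exact continuous_cinner.comp
      ((U.continuous.comp continuous_fst).prodMk (U.continuous.comp continuous_snd))
  · rw [hU, hU, cinner_linearCombination h]

/-- The equalizer of two continuous linear maps is a closed subspace. -/
theorem Total.clm_ext {G : Type*} [NormedAddCommGroup G] [NormedSpace ℂ G] (he : Total e)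
    {S T : E →L[ℂ] G} (h : ∀ i, S (e i) = T (e i)) : S = T :=
  ContinuousLinearMap.ext fun x => he (LinearMap.eqLocus S.toLinearMap T.toLinearMap)
    (isClosed_eq S.continuous T.continuous) h x

/-- Two correspondences are isomorphic if they have total families with the same Gram matrix on
which the left actions induce the same transformations of the index set. -/
theorem corrIso_of_total {ρ : A → Adj B E} {σ : A → Adj B F} (he : Total e) (hf : Total f)
    (h : ∀ i j, inner B (e i) (e j) = inner B (f i) (f j)) (g : A → ι → ι)
    (hρ : ∀ a i, ρ a (e i) = e (g a i)) (hσ : ∀ a i, σ a (f i) = f (g a i)) : CorrIso ρ σ := by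
  obtain ⟨U, hU, hUi⟩ := exists_isometry he h
  obtain ⟨V, hV, -⟩ := exists_isometry hf fun i j => (h i j).symm
  have hUV : U.comp V = .id ℂ F := hf.clm_ext fun i => by simp [hU, hV]
  have hVU : V.comp U = .id ℂ E := he.clm_ext fun i => by simp [hU, hV]
  have hUV' : ∀ y, U (V y) = y := fun y => congrArg (fun T : F →L[ℂ] F => T y) hUV
  refine ⟨U, V, fun x y => ?_, fun x => congrArg (fun T : E →L[ℂ] E => T x) hVU, hUV',
    fun a y => ?_⟩
  -- A surjective isometry has its inverse as adjoint: `⟨U x, y⟩ = ⟨U x, U (V y)⟩ = ⟨x, V y⟩`.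
  · rw [← hUi x, hUV']
  -- On the total family both sides send `f i` to `f (g a i)`.
  · have : (U.comp (ρ a).toCLM).comp V = (σ a).toCLM := hf.clm_ext fun i => by
      simp only [ContinuousLinearMap.comp_apply, hV]
      rw [hρ, hU, hσ]
    exact congrArg (fun T : F →L[ℂ] F => T y) this

end Unitary

/-! ### Total families in the Hilbert module of a kernel. -/

section KernelTotal

variable {C S Y : Type*} [NonUnitalCStarAlgebra C] [PartialOrder C]
    [StarOrderedRing C] [AddCommGroup S] [Module ℂ S] [NormedAddCommGroup Y] [NormedSpace ℂ Y]
    [SMul Cᵐᵒᵖ Y] [HilbertModule C Y]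

open PreHilbertModule SemiHilbertModule

namespace PosKernel

variable (K : PosKernel C S Y)

theorem elem_add_right (s : S) (y z : Y) : K.elem s (y + z) = K.elem s y + K.elem s z := by
  have : K.tmul s (y + z) = K.tmul s y + K.tmul s z := TensorProduct.tmul_add s y z
  exact (congrArg _ this).trans (UniformSpace.Completion.coe_add _ _)

theorem elem_smul_right (c : ℂ) (s : S) (y : Y) : K.elem s (c • y) = c • K.elem s y := by
  have : K.tmul s (c • y) = c • K.tmul s y := TensorProduct.tmul_smul c s y
  exact (congrArg _ this).trans (UniformSpace.Completion.coe_smul _ _)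

/-- Cauchy–Schwarz applied to `⟨y, K(s, s) y⟩`. It yields continuity in `y` for fixed `s`; for a
general kernel `S` carries no topology, so nothing is claimed in the other variable. -/
theorem norm_elem_sq_le (s : S) (y : Y) : ‖K.elem s y‖ ^ 2 ≤ ‖K.toFun s s‖ * ‖y‖ ^ 2 := by
  rw [norm_sq_eq (B := C), inner_elem]
  calc _ ≤ ‖y‖ * ‖K.toFun s s y‖ := norm_cinner_le _ _
    _ ≤ ‖y‖ * (‖K.toFun s s‖ * ‖y‖) := by gcongr; exact Adj.le_opNorm _ _
    _ = _ := by ring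

/-- The operator `y ↦ s ⊗ y`. -/
def elemRight (s : S) : Y →L[ℂ] K.Space :=
  LinearMap.mkContinuous ⟨⟨K.elem s, K.elem_add_right s⟩, fun c y => K.elem_smul_right c s y⟩
    √‖K.toFun s s‖ fun y => by
      refine abs_le_of_sq_le_sq' ?_ (by positivity) |>.2
      rw [mul_pow, Real.sq_sqrt (norm_nonneg _)]
      exact K.norm_elem_sq_le s y

/-- The algebraic tensor product is dense in its completion and additively generated by elementary
tensors. -/
theorem total_elem : Total fun p : S × Y => K.elem p.1 p.2 := by
  intro M hM h v
  refine UniformSpace.Completion.induction_on (α := K.Pre) v hM fun v => ?_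
  induction v using K.induction with
  | zero => exact M.zero_mem
  | tmul s y => exact h (s, y)
  | add u v hu hv =>
    rw [UniformSpace.Completion.coe_add]
    exact M.add_mem hu hv

/-- For fixed `s` the preimage of a closed subspace under `y ↦ s ⊗ y` is a closed subspace of `Y`;
if it contains the total family it is all of `Y`. Iterating this handles nested tensor products. -/
theorem total_elem_right {ι : Type*} {f : ι → Y} (hf : Total f) :
    Total fun p : S × ι => K.elem p.1 (f p.2) := fun M hM h =>
  K.total_elem M hM fun p => hf (M.comap (K.elemRight p.1).toLinearMap)
    (hM.preimage (K.elemRight p.1).continuous) (fun i => h (p.1, i)) p.2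

end PosKernel

end KernelTotal

/-! ### Total families in interior tensor products. -/

section InteriorTotal

variable {B C X Y : Type*} [NonUnitalCStarAlgebra B] [PartialOrder B] [StarOrderedRing B]
  [NonUnitalCStarAlgebra C] [PartialOrder C] [StarOrderedRing C]
  [NormedAddCommGroup X] [NormedSpace ℂ X] [SMul Bᵐᵒᵖ X] [HilbertModule B X]
  [NormedAddCommGroup Y] [NormedSpace ℂ Y] [SMul Cᵐᵒᵖ Y] [HilbertModule C Y]

open PreHilbertModule SemiHilbertModule

theorem inner_tensor_elem (φ : B →⋆ₙₐ[ℂ] Adj C Y) (x x' : X) (y y' : Y) :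
    inner C ((tensorKernel X φ).elem x y) ((tensorKernel X φ).elem x' y') =
      inner C y (φ (inner B x x') y') := PosKernel.inner_elem _ _ _ _ _

/-- A `*`-homomorphism is contractive, so `‖φ(⟨x, x⟩)‖ ≤ ‖x‖²`. This gives continuity in the left
variable as well. -/
theorem norm_tensor_elem_le (φ : B →⋆ₙₐ[ℂ] Adj C Y) (x : X) (y : Y) :
    ‖(tensorKernel X φ).elem x y‖ ≤ ‖y‖ * ‖x‖ := by
  refine abs_le_of_sq_le_sq' ?_ (by positivity) |>.2
  refine ((tensorKernel X φ).norm_elem_sq_le x y).trans ?_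
  rw [mul_pow, norm_sq_eq (B := B) x, mul_comm]
  gcongr
  exact NonUnitalStarAlgHom.norm_apply_le φ (inner B x x)

/-- The operator `x ↦ x ⊗ y` into the interior tensor product. -/
def elemLeft (φ : B →⋆ₙₐ[ℂ] Adj C Y) (y : Y) : X →L[ℂ] Interior X φ :=
  LinearMap.mkContinuous ⟨⟨fun x => (tensorKernel X φ).elem x y,
    fun x x' => (tensorKernel X φ).elem_add x x' y⟩, fun c x => (tensorKernel X φ).elem_smul c x y⟩
    ‖y‖ fun x => norm_tensor_elem_le φ x y

/-- The preimage argument is used once in each variable: the right factor is reduced to the family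
`f`, and then, for each fixed `f j`, the left factor to the family `e`. -/
theorem total_tensor_elem (φ : B →⋆ₙₐ[ℂ] Adj C Y) {ι κ : Type*} {e : ι → X} {f : κ → Y}
    (he : Total e) (hf : Total f) :
    Total fun p : ι × κ => (tensorKernel X φ).elem (e p.1) (f p.2) := fun M hM h =>
  (tensorKernel X φ).total_elem_right hf M hM fun p =>
    he (M.comap (elemLeft φ (f p.2)).toLinearMap)
      (hM.preimage (elemLeft φ (f p.2)).continuous) (fun i => h (i, p.2)) p.1

end InteriorTotal

/-! ### Strictness of `ρ ⊗ Id`. -/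

section Strict

open Filter Topology

/-- An ε/3 argument: a uniform bound on the tail of the family lets a nearby `y` control `T i x`
there. -/
theorem isClosed_setOf_cauchy_map {ι E F : Type*} [NormedAddCommGroup E] [NormedSpace ℂ E]
    [NormedAddCommGroup F] [NormedSpace ℂ F] {l : Filter ι} [l.NeBot] {T : ι → E →L[ℂ] F} {c : ℝ}
    (hT : ∀ᶠ i in l, ‖T i‖ ≤ c) : IsClosed {x | Cauchy (l.map fun i => T i x)} := by
  refine isClosed_of_closure_subset fun x hx => ?_
  refine Metric.cauchy_iff.mpr ⟨inferInstance, fun ε hε => ?_⟩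
  obtain ⟨i, hi⟩ := hT.exists
  have hc : 0 ≤ c := (norm_nonneg _).trans hi
  -- `c + 1` replaces `c` to avoid division by zero when `c = 0`.
  obtain ⟨y, hy, hxy⟩ := Metric.mem_closure_iff.mp hx (ε / (3 * (c + 1))) (by positivity)
  obtain ⟨t, ht, hd⟩ := (Metric.cauchy_iff.mp hy).2 (ε / 3) (by positivity)
  have hn : ∀ i, ‖T i‖ ≤ c → dist (T i x) (T i y) < ε / 3 := fun i hi => by
    rw [dist_eq_norm, ← map_sub]
    rw [dist_eq_norm] at hxy
    calc _ ≤ ‖T i‖ * ‖x - y‖ := (T i).le_opNorm _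
      _ ≤ (c + 1) * ‖x - y‖ := by gcongr; linarith
      _ < (c + 1) * (ε / (3 * (c + 1))) := by gcongr
      _ = ε / 3 := by field_simp
  refine ⟨_, image_mem_map (inter_mem (mem_map.mp ht) hT), ?_⟩
  rintro _ ⟨i, ⟨hi, hi'⟩, rfl⟩ _ ⟨j, ⟨hj, hj'⟩, rfl⟩
  have h1 := hn i hi'
  have h2 := hn j hj'
  rw [dist_comm] at h2
  have h3 := hd _ hi _ hj
  have h4 := dist_triangle4 (T i x) (T i y) (T j y) (T j x)
  linarith

/-- The vectors on which a bounded family is Cauchy form a closed subspace. Completeness of `F`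
turns Cauchy into convergent, so that limits can be added and scaled. -/
theorem cauchy_map_of_total {ι κ E F : Type*} [NormedAddCommGroup E] [NormedSpace ℂ E]
    [NormedAddCommGroup F] [NormedSpace ℂ F] [CompleteSpace F] {l : Filter ι} [l.NeBot]
    {T : ι → E →L[ℂ] F} {c : ℝ} (hT : ∀ᶠ i in l, ‖T i‖ ≤ c) {e : κ → E} (he : Total e)
    (h : ∀ k, Cauchy (l.map fun i => T i (e k))) (x : E) : Cauchy (l.map fun i => T i x) := by
  let M : Submodule ℂ E :=
    { carrier := {x | Cauchy (l.map fun i => T i x)}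
      zero_mem' := cauchy_map_iff_exists_tendsto.mpr ⟨0, by simp⟩
      add_mem' := fun {x y} hx hy => by
        obtain ⟨a, ha⟩ := cauchy_map_iff_exists_tendsto.mp hx
        obtain ⟨b, hb⟩ := cauchy_map_iff_exists_tendsto.mp hy
        exact cauchy_map_iff_exists_tendsto.mpr ⟨a + b, by simpa using ha.add hb⟩
      smul_mem' := fun r x hx => by
        obtain ⟨a, ha⟩ := cauchy_map_iff_exists_tendsto.mp hx
        exact cauchy_map_iff_exists_tendsto.mpr ⟨r • a, by simpa using ha.const_smul r⟩ }
  exact he M (isClosed_setOf_cauchy_map hT) h x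

variable {A B C X Y : Type*} [NonUnitalCStarAlgebra A] [PartialOrder A] [StarOrderedRing A]
  [NonUnitalCStarAlgebra B] [PartialOrder B] [StarOrderedRing B]
  [NonUnitalCStarAlgebra C] [PartialOrder C] [StarOrderedRing C]
  [NormedAddCommGroup X] [NormedSpace ℂ X] [SMul Bᵐᵒᵖ X] [HilbertModule B X]
  [NormedAddCommGroup Y] [NormedSpace ℂ Y] [SMul Cᵐᵒᵖ Y] [HilbertModule C Y]

/-- Positive linear maps between C*-algebras are automatically bounded, and an approximate unit is
eventually contractive. -/
theorem exists_norm_le_of_isIncreasingApproximateUnit (ρ : A →CP Adj B X) {l : Filter A}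
    (hl : l.IsIncreasingApproximateUnit) : ∃ c : ℝ, ∀ᶠ a in l, ‖ρ a‖ ≤ c := by
  obtain ⟨c, hc⟩ := PositiveLinearMap.exists_norm_apply_le (.ofClass ρ)
  refine ⟨c, hl.eventually_norm.mono fun a ha => (hc a).trans ?_⟩
  exact mul_le_of_le_one_right c.2 ha

theorem tensorId_elem (ρ : A →CP Adj B X) (φ : B →⋆ₙₐ[ℂ] Adj C Y) (a : A) (x : X) (y : Y) :
    tensorId ρ φ a ((tensorKernel X φ).elem x y) = (tensorKernel X φ).elem (ρ a x) y :=
  amplify_elem φ (ρ a) x y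

theorem star_tensorId_elem (ρ : A →CP Adj B X) (φ : B →⋆ₙₐ[ℂ] Adj C Y) (a : A) (x : X) (y : Y) :
    star (tensorId ρ φ a) ((tensorKernel X φ).elem x y) =
      (tensorKernel X φ).elem (star (ρ a) x) y := by
  rw [← cp_map_star, ← cp_map_star, tensorId_elem]

/-- The approximate unit of `ρ` is kept. On `x ⊗ y` the image filter is that of `ρ(aᵢ) x`, or of its
adjoint version, under the uniformly continuous map `x ↦ x ⊗ y`. One norm bound serves the operators
and their adjoints. -/
theorem isStrict_tensorId {ρ : A →CP Adj B X} (hρ : IsStrict ρ) (φ : B →⋆ₙₐ[ℂ] Adj C Y) :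
    IsStrict (tensorId ρ φ) := by
  obtain ⟨l, hl, h1, h2⟩ := hρ
  have := hl.neBot
  have : CompleteSpace (Interior X φ) := HilbertModule.complete C
  obtain ⟨c, hc⟩ := exists_norm_le_of_isIncreasingApproximateUnit (tensorId ρ φ) hl
  refine ⟨l, hl, cauchy_map_of_total (T := fun a => (tensorId ρ φ a).toCLM) hc
      (tensorKernel X φ).total_elem fun p => ?_,
    cauchy_map_of_total (T := fun a => (star (tensorId ρ φ a)).toCLM) (c := c)
      (hc.mono fun a ha => ?_) (tensorKernel X φ).total_elem fun p => ?_⟩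
  · simp only [tensorId_elem]
    exact (h1 p.1).map (elemLeft φ p.2).uniformContinuous
  · exact (norm_star (tensorId ρ φ a)).le.trans ha
  · simp only [star_tensorId_elem]
    exact (h2 p.1).map (elemLeft φ p.2).uniformContinuous

theorem isStrict_compose {ρ : A →CP Adj B X} (hρ : IsStrict ρ) (σ : B →CP Adj C Y) :
    IsStrict (compose ρ σ) := isStrict_tensorId hρ _

end Strict

/-! ### The isomorphisms, by comparison of Gram matrices. -/

section Associativity

variable {A B C D X X' Y Y' Z : Type*}
  [NonUnitalCStarAlgebra A] [PartialOrder A] [StarOrderedRing A]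
  [NonUnitalCStarAlgebra B] [PartialOrder B] [StarOrderedRing B]
  [NonUnitalCStarAlgebra C] [PartialOrder C] [StarOrderedRing C]
  [NonUnitalCStarAlgebra D] [PartialOrder D] [StarOrderedRing D]
  [NormedAddCommGroup X] [NormedSpace ℂ X] [SMul Bᵐᵒᵖ X] [HilbertModule B X]
  [NormedAddCommGroup X'] [NormedSpace ℂ X'] [SMul Bᵐᵒᵖ X'] [HilbertModule B X']
  [NormedAddCommGroup Y] [NormedSpace ℂ Y] [SMul Cᵐᵒᵖ Y] [HilbertModule C Y]
  [NormedAddCommGroup Y'] [NormedSpace ℂ Y'] [SMul Cᵐᵒᵖ Y'] [HilbertModule C Y']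
  [NormedAddCommGroup Z] [NormedSpace ℂ Z] [SMul Dᵐᵒᵖ Z] [HilbertModule D Z]

theorem inner_ksgns_elem (ρ : A →CP Adj B X) (a a' : A) (x x' : X) :
    inner B ((ksgnsKernel ρ).elem a x) ((ksgnsKernel ρ).elem a' x') =
      inner B x (ρ (star a * a') x') := PosKernel.inner_elem _ _ _ _ _

theorem compose_elem (ρ : A →CP Adj B X) (σ : B →CP Adj C Y) (a : A) (x : X) (w : KSGNS σ) :
    compose ρ σ a ((tensorKernel X (ksgnsAction σ)).elem x w) =
      (tensorKernel X (ksgnsAction σ)).elem (ρ a x) w := tensorId_elem ρ _ a x w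

/-- `(A ⊗_ρ X) ⊗_B Y ≅ A ⊗_{ρ ⊗ Id} (X ⊗_B Y)`. -/
theorem corrIso_ksgns_tensorId (ρ : A →CP Adj B X) (φ : B →⋆ₙₐ[ℂ] Adj C Y) :
    CorrIso (fun a => amplify (KSGNS ρ) φ (ksgnsAction ρ a))
      (fun a => ksgnsAction (tensorId ρ φ) a) := by
  refine corrIso_of_total
    (e := fun p : A × X × Y =>
      (tensorKernel (KSGNS ρ) φ).elem ((ksgnsKernel ρ).elem p.1 p.2.1) p.2.2)
    (f := fun p : A × X × Y =>
      (ksgnsKernel (tensorId ρ φ)).elem p.1 ((tensorKernel X φ).elem p.2.1 p.2.2)) ?_ ?_ ?_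
    (fun a p => (a * p.1, p.2)) ?_ ?_
  -- Only the index set is rebracketed, from `(A × X) × Y` to `A × X × Y`.
  · exact fun M hM h => total_tensor_elem φ (ksgnsKernel ρ).total_elem
      (total_of_surjective Function.surjective_id) M hM fun p => h (p.1.1, p.1.2, p.2)
  · exact (ksgnsKernel (tensorId ρ φ)).total_elem_right (tensorKernel X φ).total_elem
  -- Both entries reduce to `⟨y, φ(⟨x, ρ(a* a') x'⟩) y'⟩`.
  · intro p q
    rw [inner_tensor_elem, inner_ksgns_elem, inner_ksgns_elem, tensorId_elem, inner_tensor_elem]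
  · intro a p
    rw [amplify_elem, ksgnsAction_elem]
  · intro a p
    rw [ksgnsAction_elem]

/-- The tensors `(x ⊗ (b ⊗ y)) ⊗ w` and `x ⊗ (b ⊗ (y ⊗ w))` correspond. The space `KSGNS τ` occurs
unchanged on both sides, so `w` ranges over all of it and need not be split into elementary tensors.
-/
theorem corrIso_compose_assoc (ρ : A →CP Adj B X) (σ : B →CP Adj C Y) (τ : C →CP Adj D Z) :
    CorrIso (fun a => compose (compose ρ σ) τ a) (fun a => compose ρ (compose σ τ) a) := by
  refine corrIso_of_total
    (e := fun p : X × B × Y × KSGNS τ =>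
      (tensorKernel _ (ksgnsAction τ)).elem
        ((tensorKernel X (ksgnsAction σ)).elem p.1 ((ksgnsKernel σ).elem p.2.1 p.2.2.1)) p.2.2.2)
    (f := fun p : X × B × Y × KSGNS τ =>
      (tensorKernel X (ksgnsAction (compose σ τ))).elem p.1
        ((ksgnsKernel (compose σ τ)).elem p.2.1
          ((tensorKernel Y (ksgnsAction τ)).elem p.2.2.1 p.2.2.2))) ?_ ?_ ?_
    (fun a p => (ρ a p.1, p.2)) ?_ ?_
  · exact fun M hM h => total_tensor_elem _
      ((tensorKernel X (ksgnsAction σ)).total_elem_right (ksgnsKernel σ).total_elem)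
      (total_of_surjective Function.surjective_id) M hM
      fun p => h (p.1.1, p.1.2.1, p.1.2.2, p.2)
  · exact (tensorKernel X (ksgnsAction (compose σ τ))).total_elem_right
      ((ksgnsKernel (compose σ τ)).total_elem_right (tensorKernel Y (ksgnsAction τ)).total_elem)
  -- On the left, `π_σ(⟨x, x'⟩)` acts inside the argument of `π_τ`; on the right, `(σ ⊗ Id)(b* ⟨x,
  -- x'⟩ b')` acts on `y' ⊗ w'`. Both give `⟨w, π_τ(⟨y, σ(b* ⟨x, x'⟩ b') y'⟩) w'⟩`.
  · intro p q
    rw [inner_tensor_elem, inner_tensor_elem, ksgnsAction_elem, inner_ksgns_elem,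
      inner_tensor_elem, ksgnsAction_elem, inner_ksgns_elem, compose_elem, inner_tensor_elem]
  · intro a p
    rw [compose_elem, compose_elem]
  · intro a p
    rw [compose_elem]

/-- Surjectivity supplies totality, and the other two properties supply the Gram matrices and
actions; linearity of `U` is not needed for the comparison. -/
theorem CorrIso.exists_intertwiner {ρ : A → Adj B X} {ρ' : A → Adj B X'} (h : CorrIso ρ ρ') :
    ∃ U : X → X', Function.Surjective U ∧ (∀ x x', inner B (U x) (U x') = inner B x x') ∧
      ∀ a x, ρ' a (U x) = U (ρ a x) := by
  obtain ⟨U, V, h1, h2, h3, h4⟩ := h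
  refine ⟨U, fun y => ⟨V y, h3 y⟩, fun x x' => by rw [h1, h2], fun a x => ?_⟩
  rw [← h4, h2]

/-- The tensor `x ⊗ (b ⊗ y)` is matched with `U x ⊗ (b ⊗ W y)`. The Gram matrices agree because `⟨U
x, U x'⟩ = ⟨x, x'⟩` and `⟨W y, σ'(c) W y'⟩ = ⟨W y, W σ(c) y'⟩ = ⟨y, σ(c) y'⟩`. -/
theorem corrIso_compose_congr {ρ : A →CP Adj B X} {ρ' : A →CP Adj B X'} {σ : B →CP Adj C Y}
    {σ' : B →CP Adj C Y'} (hρ : CorrIso ρ ρ') (hσ : CorrIso σ σ') :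
    CorrIso (compose ρ σ) (compose ρ' σ') := by
  obtain ⟨U, hU, hUi, hUρ⟩ := hρ.exists_intertwiner
  obtain ⟨W, hW, hWi, hWσ⟩ := hσ.exists_intertwiner
  refine corrIso_of_total
    (e := fun p : X × B × Y =>
      (tensorKernel X (ksgnsAction σ)).elem p.1 ((ksgnsKernel σ).elem p.2.1 p.2.2))
    (f := fun p : X × B × Y =>
      (tensorKernel X' (ksgnsAction σ')).elem (U p.1) ((ksgnsKernel σ').elem p.2.1 (W p.2.2)))
    ?_ ?_ ?_ (fun a p => (ρ a p.1, p.2)) ?_ ?_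
  · exact (tensorKernel X (ksgnsAction σ)).total_elem_right (ksgnsKernel σ).total_elem
  · exact total_tensor_elem (ksgnsAction σ') (e := U)
      (f := fun p : B × Y => (ksgnsKernel σ').elem p.1 (W p.2)) (total_of_surjective hU)
      ((ksgnsKernel σ').total_elem_right (total_of_surjective hW))
  · intro p q
    rw [inner_tensor_elem, inner_tensor_elem, ksgnsAction_elem, ksgnsAction_elem,
      inner_ksgns_elem, inner_ksgns_elem, hUi, hWσ, hWi]
  · intro a p
    rw [compose_elem]
  · intro a p
    rw [compose_elem, hUρ]

end Associativity

/-! ### Composition of isomorphism classes. -/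

section Classes

/-- The composition of bundled strict positive correspondences. -/
def StrictCorr.comp {P Q R : CAlg.{u}} (E : StrictCorr P Q) (F : StrictCorr Q R) :
    StrictCorr P R :=
  .mk (Interior E.carrier (ksgnsAction F.map)) (compose E.map F.map)
    (isStrict_compose E.strict F.map)

/-- The composition of isomorphism classes of strict positive correspondences. -/
def IsoClass.comp {P Q R : CAlg.{u}} : IsoClass P Q → IsoClass Q R → IsoClass P R :=
  Quotient.map₂ StrictCorr.comp fun _ _ hE _ _ hF => corrIso_compose_congr hE hF

theorem IsoClass.comp_assoc {P Q R S : CAlg.{u}} (p : IsoClass P Q) (q : IsoClass Q R)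
    (r : IsoClass R S) : (p.comp q).comp r = p.comp (q.comp r) := by
  induction p using Quotient.inductionOn with | _ E
  induction q using Quotient.inductionOn with | _ F
  induction r using Quotient.inductionOn with | _ G
  exact Quotient.sound (corrIso_compose_assoc E.map F.map G.map)

end Classes

end CStarCorr

end

/-! ### The three claims together. -/

theorem mainTheorem2 {A B C D : Type u}
    [NonUnitalCStarAlgebra A] [PartialOrder A] [StarOrderedRing A]
    [NonUnitalCStarAlgebra B] [PartialOrder B] [StarOrderedRing B]
    [NonUnitalCStarAlgebra C] [PartialOrder C] [StarOrderedRing C]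
    [NonUnitalCStarAlgebra D] [PartialOrder D] [StarOrderedRing D] :
    -- `ρ ⊗ Id` is strict completely positive, and its KSGNS space is `(A ⊗_ρ X) ⊗_B Y`
    (∀ (X Y : Type v)
      [NormedAddCommGroup X] [NormedSpace ℂ X] [SMul Bᵐᵒᵖ X] [HilbertModule B X]
      [NormedAddCommGroup Y] [NormedSpace ℂ Y] [SMul Cᵐᵒᵖ Y] [HilbertModule C Y]
      (ρ : A →CP Adj B X) (φ : B →⋆ₙₐ[ℂ] Adj C Y), IsStrict ρ →
        (∀ (a : A) (x : X) (y : Y),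
          tensorId ρ φ a ((tensorKernel X φ).elem x y) = (tensorKernel X φ).elem (ρ a x) y) ∧
        IsStrict (tensorId ρ φ) ∧
        CorrIso (fun a => amplify (KSGNS ρ) φ (ksgnsAction ρ a))
          (fun a => ksgnsAction (tensorId ρ φ) a)) ∧
    -- composition of strict positive correspondences is associative up to isomorphism
    (∀ (X Y Z : Type v)
      [NormedAddCommGroup X] [NormedSpace ℂ X] [SMul Bᵐᵒᵖ X] [HilbertModule B X]
      [NormedAddCommGroup Y] [NormedSpace ℂ Y] [SMul Cᵐᵒᵖ Y] [HilbertModule C Y]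
      [NormedAddCommGroup Z] [NormedSpace ℂ Z] [SMul Dᵐᵒᵖ Z] [HilbertModule D Z]
      (ρ : A →CP Adj B X) (σ : B →CP Adj C Y) (τ : C →CP Adj D Z),
        IsStrict ρ → IsStrict σ → IsStrict τ →
        CorrIso (fun a => compose (compose ρ σ) τ a) (fun a => compose ρ (compose σ τ) a)) ∧
    -- composition is a well-defined associative operation on isomorphism classes
    (∃ comp : ∀ {P Q R : CAlg.{u}}, IsoClass P Q → IsoClass Q R → IsoClass P R,
      (∀ (P Q R : CAlg.{u}) (E : StrictCorr P Q) (F : StrictCorr Q R),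
        ∃ h : IsStrict (compose E.map F.map),
          comp E.isoClass F.isoClass =
            (StrictCorr.mk (Interior E.carrier (ksgnsAction F.map))
              (compose E.map F.map) h).isoClass) ∧
      ∀ (P Q R S : CAlg.{u}) (p : IsoClass P Q) (q : IsoClass Q R) (r : IsoClass R S),
        comp (comp p q) r = comp p (comp q r)) := by
  refine ⟨fun X Y _ _ _ _ _ _ _ _ ρ φ hρ =>
      ⟨tensorId_elem ρ φ, isStrict_tensorId hρ φ, corrIso_ksgns_tensorId ρ φ⟩,
    fun X Y Z _ _ _ _ _ _ _ _ _ _ _ _ ρ σ τ _ _ _ => corrIso_compose_assoc ρ σ τ,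
    -- `rfl` suffices because `Quotient.map₂` computes on representatives and `StrictCorr.comp`
    -- unfolds to the displayed correspondence.
    IsoClass.comp, fun P Q R E F => ⟨isStrict_compose E.strict F.map, rfl⟩,
    fun P Q R S => IsoClass.comp_assoc⟩
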